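/- **Notation.** Let $d$ be a dimension and identify $\mathbb R^{d}$ with the hyperplane of $\mathbb R^{d+1}=\{(x,\xi): x\in\mathbb R^d,\ \xi\in\mathbb R\}$ spanned by the first $d$ standard basis vectors. Let $B^{n}$ be the closed Euclidean unit ball of $\mathbb R^{n}$; bd denotes the boundary, $\bar u\otimes\bar u$ is the matrix $\bar u\bar u^{\top}$, and $A\oplus\alpha=\begin{pmatrix}A&0\\0&\alpha\end{pmatrix}$. An *ellipsoid* in $\mathbb R^n$ is a set $A B^n+a$ with $A$ a positive definite matrix and $a\in\mathbb R^n$. A set $C\subseteq\mathbb R^{d+1}$ is *$d$-symmetric* if it is invariant under $(x,\xi)\mapsto(x,-\xi)$. The $d$-symmetric ellipsoids are the sets $(A\oplus\alpha)B^{d+1}+a$ with $A\in\mathbb R^{d\times d}$ positive definite, $\alpha>0$ and $a\in\mathbb R^d$; neighbourhoods of such an ellipsoid are understood with respect to the parameters $(A\oplus\alpha,a)$. For $s>0$ the *$s$-volume* of a $d$-symmetric Borel set $C$ is $\int_{\mathbb R^d}\left[\tfrac12\,\mathrm{length}(C\cap\ell_x)\right]^s dx$, where $\ell_x$ is the line perpendicular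 to $\mathbb R^d$ at $x$; its *$s$-marginal* is the measure on $\mathbb R^d$ whose density is this integrand. A function $f:\mathbb R^d\to[0,\infty)$ is *log-concave* if $f=e^{-\psi}$ with $\psi:\mathbb R^d\to\mathbb R\cup\{\infty\}$ convex, and *proper log-concave* if it is moreover upper semicontinuous with finite positive integral. Its *$s$-lifting* is $\{(x,\xi):|\xi|\le f(x)^{1/s}\}$. The *John $s$-ellipsoid* of $f$ is the unique $d$-symmetric ellipsoid of maximal $s$-volume contained in the $s$-lifting of $f$, and the *John $s$-function* of $f$ is the density of the $s$-marginal of the John $s$-ellipsoid. Put $h(x)=\sqrt{1-|x|^2}$ for $|x|\le1$ and $h(x)=0$ otherwise. **Theorem.** 1. Let $s>0$ and let $K\subseteq\mathbb R^{d+1}$ be a closed $d$-symmetric set with $B^{d+1}\subseteq K$. Assume that $B^{d+1}$ is a locally maximal $s$-volume ellipsoid in $K$, that is, in some neighbourhood of $B^{d+1}$ no $d$-symmetric ellipsoid contained in $K$ has larger $s$-volume. Then there are contact points $\bar u_1,\dots,\bar u_k\in\mathrm{bd}(B^{d+1})\cap\mathrm{bd}(K)$ and positive weights $c_1,\dots,c_k$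 such that $$\sum_{i=1}^k c_i\,\bar u_i\otimes\bar u_i=I\oplus s\quad\text{and}\quad\sum_{i=1}^k c_iu_i=0,\qquad(*)$$ where $u_i$ is the orthogonal projection of $\bar u_i$ to $\mathbb R^d$. Moreover, such points and weights exist for some $k$ with $d+1\le k\le\frac{(d+1)(d+2)}2+d+1$. 2. Let $s>0$, let $f$ be a proper log-concave function on $\mathbb R^d$ and let $K$ be its $s$-lifting. If $B^{d+1}\subseteq K$ and there are contact points and positive weights satisfying $(*)$, then $B^{d+1}$ is the unique ellipsoid of globally maximum $s$-volume among the $d$-symmetric ellipsoids contained in $K$. 3. Let $f$ be an upper semicontinuous log-concave function on $\mathbb R^d$ of positive (possibly infinite) integral and let $K=\{(x,\xi)\in\mathbb R^{d+1}:|\xi|\le f(x)/2\}$. If $B^{d+1}\subseteq K$, then $B^{d+1}$ is the unique maximum volume ellipsoid among all ellipsoids contained in $K$ if and only if there are contact points $\bar u_1,\dots,\bar u_k\in\mathrm{bd}(B^{d+1})\cap\mathrm{bd}(K)$ and positive weights $c_1,\dots,c_k$ with $\sum_i c_i\,\bar u_i\otimes\bar u_i=I$ (the $(d+1)\times(d+1)$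 identity matrix) and $\sum_i c_iu_i=0$, where $u_i$ is the orthogonal projection of $\bar u_i$ to $\mathbb R^d$. 4. Let $s>0$ and let $f$ be a proper log-concave function on $\mathbb R^d$ with $h^s\le f$. Then $h^s$ is the John $s$-function of $f$ if and only if there are points $u_1,\dots,u_k\in B^d$ and positive weights $c_1,\dots,c_k$ such that (a) for every $i$, either $f(u_i)=h(u_i)^s$ or $u_i\in\mathrm{bd}\{f>0\}$; (b) $\sum_i c_i\,u_i\otimes u_i=I$ (the $d\times d$ identity matrix); (c) $\sum_i c_i\,h(u_i)^2=s$; (d) $\sum_i c_iu_i=0$. -/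

import Mathlib

open MeasureTheory Set Topology
open scoped ENNReal Matrix

namespace FunctionalJohn

/-- The Euclidean space `ℝ^d`. -/
abbrev Rd (d : ℕ) := EuclideanSpace ℝ (Fin d)

/-- The Euclidean space `ℝ^(d+1)`. The coordinates `Sum.inl i` are the first `d` ones and
`Sum.inr ()` is the last one. -/
abbrev RdOne (d : ℕ) := EuclideanSpace ℝ (Fin d ⊕ Unit)

variable {d : ℕ}

/-- The point `(x, ξ)` of `ℝ^(d+1)`. -/
def pt (x : Rd d) (ξ : ℝ) : RdOne d :=
  WithLp.toLp 2 (Sum.elim (fun i => x i) (fun _ => ξ))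

/-- The orthogonal projection of `ℝ^(d+1)` to `ℝ^d`, with values in `ℝ^d`. -/
def proj (z : RdOne d) : Rd d := WithLp.toLp 2 (fun i => z (Sum.inl i))

/-- The last coordinate of a point of `ℝ^(d+1)`. -/
def last (z : RdOne d) : ℝ := z (Sum.inr ())

/-- The closed Euclidean unit ball of `ℝ^(d+1)`. -/
def unitBall (d : ℕ) : Set (RdOne d) := Metric.closedBall 0 1

/-- `C` is symmetric about `ℝ^d`, that is, `(2P - I) C = C`, where `P` is the orthogonal projection
onto the hyperplane `ℝ^d` of `ℝ^(d+1)`. -/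
def IsDSymmetric (C : Set (RdOne d)) : Prop :=
  (fun z => (2 : ℝ) • pt (proj z) 0 - z) '' C = C

/-- The block diagonal matrix `A ⊕ α`. -/
def oplus (A : Matrix (Fin d) (Fin d) ℝ) (α : ℝ) : Matrix (Fin d ⊕ Unit) (Fin d ⊕ Unit) ℝ :=
  Matrix.fromBlocks A 0 0 (Matrix.diagonal fun _ => α)

/-- The set `A B + a`, where `B` is the closed unit ball. -/
def affineBall {ι : Type*} [Fintype ι] (A : Matrix ι ι ℝ) (a : EuclideanSpace ℝ ι) :
    Set (EuclideanSpace ℝ ι) :=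
  (fun z : EuclideanSpace ℝ ι => WithLp.toLp 2 (A *ᵥ z.ofLp) + a) '' Metric.closedBall 0 1

/-- Ellipsoids: the sets `A B + a` with `A` positive definite. -/
def IsEllipsoid {ι : Type*} [Fintype ι] (E : Set (EuclideanSpace ℝ ι)) : Prop :=
  ∃ (A : Matrix ι ι ℝ) (a : EuclideanSpace ℝ ι), A.PosDef ∧ E = affineBall A a

/-- The parameters `(A ⊕ α, a)`, with `A` positive definite, `α > 0` and `a ∈ ℝ^d`, of the
`d`-symmetric ellipsoids. -/
def ellipsoidParams (d : ℕ) : Set (Matrix (Fin d ⊕ Unit) (Fin d ⊕ Unit) ℝ × Rd d) :=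
  {p | ∃ (A : Matrix (Fin d) (Fin d) ℝ) (α : ℝ), A.PosDef ∧ 0 < α ∧ p.1 = oplus A α}

/-- The subset `(A ⊕ α) B + a` of `ℝ^(d+1)` represented by `(A ⊕ α, a)`. -/
def body (p : Matrix (Fin d ⊕ Unit) (Fin d ⊕ Unit) ℝ × Rd d) : Set (RdOne d) :=
  affineBall p.1 (pt p.2 0)

/-- `d`-symmetric ellipsoids in `ℝ^(d+1)`. -/
def IsDSymmetricEllipsoid (E : Set (RdOne d)) : Prop :=
  ∃ p ∈ ellipsoidParams d, E = body p

/-- The `s`-volume: the integral over `x ∈ ℝ^d` of the `s`-th power of half of the length of the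
section of `C` by the line through `x` perpendicular to `ℝ^d`. -/
noncomputable def sVolume (s : ℝ) (C : Set (RdOne d)) : ℝ≥0∞ :=
  ∫⁻ x : Rd d, (volume {ξ : ℝ | pt x ξ ∈ C} / 2) ^ s

/-- The `s`-marginal of `C`: the measure on `ℝ^d` giving to `B` the integral of
`x ↦ (length (C ∩ ℓ_x) / 2) ^ s` over `B`. -/
noncomputable def sMarginal (s : ℝ) (C : Set (RdOne d)) : Measure (Rd d) :=
  volume.withDensity fun x => (volume {ξ : ℝ | pt x ξ ∈ C} / 2) ^ s

/-- The `s`-lifting of `f`. -/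
def sLift (s : ℝ) (f : Rd d → ℝ) : Set (RdOne d) :=
  {z | |last z| ≤ f (proj z) ^ (1 / s)}

/-- The symmetrized subgraph of `f`. -/
def symmSubgraph (f : Rd d → ℝ) : Set (RdOne d) :=
  {z | |last z| ≤ f (proj z) / 2}

/-- Log-concave functions: `f = exp (-ψ)` with `ψ : ℝ^d → ℝ ∪ {∞}` convex, written as an inequality
for `f`; the value `0` of `f` corresponds to the value `∞` of `ψ`. -/
def IsLogConcave (f : Rd d → ℝ) : Prop :=
  (∀ x, 0 ≤ f x) ∧
    ∀ x y : Rd d, ∀ t : ℝ, 0 < t → t < 1 →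
      f x ^ (1 - t) * f y ^ t ≤ f ((1 - t) • x + t • y)

/-- Proper log-concave functions: upper semicontinuous and of finite positive integral. -/
def IsProperLogConcave (f : Rd d → ℝ) : Prop :=
  IsLogConcave f ∧ UpperSemicontinuous f ∧ Integrable f ∧ 0 < ∫ x, f x

/-- No `d`-symmetric ellipsoid contained in `K`, in some neighbourhood of the unit ball (whose
parameters are `(I, 0)`), has larger `s`-volume than the unit ball. -/
def UnitBallLocallyMaximal (s : ℝ) (K : Set (RdOne d)) : Prop :=
  ∀ᶠ p in 𝓝 ((1, 0) : Matrix (Fin d ⊕ Unit) (Fin d ⊕ Unit) ℝ × Rd d),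
    p ∈ ellipsoidParams d → body p ⊆ K → sVolume s (body p) ≤ sVolume s (unitBall d)

/-- `E` is the unique member of the class `P` contained in `K` that maximizes `v` among the members
of `P` contained in `K`. -/
def IsUniqueMaximizer (P : Set (RdOne d) → Prop) (v : Set (RdOne d) → ℝ≥0∞)
    (K E : Set (RdOne d)) : Prop :=
  P E ∧ E ⊆ K ∧ ∀ E', P E' → E' ⊆ K → v E' ≤ v E ∧ (v E' = v E → E' = E)

/-- The points `u i` are contact points of the unit ball and `K`, the weights `c i` are positive,
`∑ c_i u_i ⊗ u_i = S`, and the projections of the `u i` satisfy `∑ c_i u_i = 0`. -/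
def IsJohnDecomposition (K : Set (RdOne d)) (S : Matrix (Fin d ⊕ Unit) (Fin d ⊕ Unit) ℝ) {k : ℕ}
    (u : Fin k → RdOne d) (c : Fin k → ℝ) : Prop :=
  (∀ i, u i ∈ frontier (unitBall d) ∩ frontier K) ∧ (∀ i, 0 < c i) ∧
    ∑ i, c i • Matrix.vecMulVec (u i).ofLp (u i).ofLp = S ∧
    ∑ i, c i • proj (u i) = 0

/-- `E` is the John `s`-ellipsoid of `f`. -/
def IsJohnEllipsoid (s : ℝ) (f : Rd d → ℝ) (E : Set (RdOne d)) : Prop :=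
  IsUniqueMaximizer IsDSymmetricEllipsoid (sVolume s) (sLift s f) E

/-- `g` is the John `s`-function of `f`: a density of the `s`-marginal of the John `s`-ellipsoid
of `f`. -/
def IsJohnFunction (s : ℝ) (f g : Rd d → ℝ) : Prop :=
  ∃ E, IsJohnEllipsoid s f E ∧ sMarginal s E = volume.withDensity fun x => ENNReal.ofReal (g x)

open Classical in
/-- The height function of the unit ball of `ℝ^(d+1)`. -/
noncomputable def ballHeight (x : Rd d) : ℝ :=
  if ‖x‖ ≤ 1 then Real.sqrt (1 - ‖x‖ ^ 2) else 0

end FunctionalJohn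

open FunctionalJohn

namespace FunctionalJohn

/-! ### Points `(x, ξ)` of `ℝ^(d+1)`, the height function of the ball, bodies between the graphs of
`±g` -/

section Coordinates

variable {d : ℕ}

/-! Write the body as `|ξ| ≤ g(x)` with `g` log-concave (`g = f^(1/s)` for a lifting, `g = f/2` for
the symmetrized subgraph), and let `h` be the height of the ball.

Sufficiency is a tangency argument. At a contact point over `u` with `‖u‖ < 1`, `log g` lies below
the tangent plane of `log h` at `u`; if `‖u‖ = 1`, then `{g > 0}` lies in the half-space `⟨u, x⟩ ≤
1`. If the ellipsoid with parameters `(P ⊕ r, a)` lies in the body, evaluating these bounds at `P u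
+ a` gives `ξ² log r + ⟨u, P u⟩ + ⟨u, a⟩ ≤ ‖u‖²` (`log_add_inner_le_of_mem_frontier`). The weighted
sum is `s log r + tr P ≤ d`, and `log det P ≤ tr P - d` then yields `r^s det P ≤ 1`, the ratio of
`s`-volumes; the equality cases force `P = 1`, `r = 1`, `a = 0` (`IsContactSystem.det_le_one`). A
general ellipsoid is first written with a lower triangular block matrix: its vertical sections are
segments, and centring them at height `0` keeps both the volume and the inclusion, so the same
estimate applies with `s = 1`. A contact point with `‖u‖ < 1` then shows that the sections of an
extremal ellipsoid were already centred.

Necessity is a separation argument. If `(I ⊕ s, 0)/(d + s)` is not in the convex hull of the pairs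
`(z ⊗ z, proj z)` over contact points `z`, a separating functional gives a direction `(H ⊕ β, b)`
that pushes every contact point strictly into the ball while the `s`-volume grows to first order
(`mem_convexHull_of_unitBallLocallyMaximal`, `not_unitBallLocallyMaximal`). Carathéodory's theorem
bounds the number of points. -/

@[simp] lemma proj_pt (x : Rd d) (ξ : ℝ) : proj (pt x ξ) = x := by
  ext i; simp [proj, pt]

@[simp] lemma last_pt (x : Rd d) (ξ : ℝ) : last (pt x ξ) = ξ := by
  simp [last, pt]

@[simp] lemma pt_proj_last (z : RdOne d) : pt (proj z) (last z) = z := by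
  ext i; rcases i with i | i <;> simp [proj, pt, last]

lemma pt_add (x y : Rd d) (ξ η : ℝ) : pt x ξ + pt y η = pt (x + y) (ξ + η) := by
  ext i; rcases i with i | i <;> simp [pt]

lemma smul_pt (c : ℝ) (x : Rd d) (ξ : ℝ) : c • pt x ξ = pt (c • x) (c * ξ) := by
  ext i; rcases i with i | i <;> simp [pt]

lemma pt_sub (x y : Rd d) (ξ η : ℝ) : pt x ξ - pt y η = pt (x - y) (ξ - η) := by
  ext i; rcases i with i | i <;> simp [pt]

lemma pt_inj {x y : Rd d} {ξ η : ℝ} : pt x ξ = pt y η ↔ x = y ∧ ξ = η := by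
  constructor
  · intro h
    exact ⟨by simpa using congrArg proj h, by simpa using congrArg last h⟩
  · rintro ⟨rfl, rfl⟩; rfl

lemma pt_zero_zero : pt (0 : Rd d) 0 = 0 := by
  ext i; rcases i with i | i <;> simp [pt]

lemma norm_sq_pt (x : Rd d) (ξ : ℝ) : ‖pt x ξ‖ ^ 2 = ‖x‖ ^ 2 + ξ ^ 2 := by
  simp [EuclideanSpace.norm_sq_eq, pt]

lemma continuous_pt : Continuous fun p : Rd d × ℝ => pt p.1 p.2 := by
  refine (PiLp.continuous_toLp 2 _).comp (continuous_pi fun i => ?_)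
  rcases i with i | i
  · simp only [Sum.elim_inl]; fun_prop
  · simp only [Sum.elim_inr]; fun_prop

lemma continuous_proj : Continuous (proj : RdOne d → Rd d) := by
  unfold proj; fun_prop

lemma continuous_last : Continuous (last : RdOne d → ℝ) := by
  unfold last; fun_prop

lemma pt_mem_unitBall {x : Rd d} {ξ : ℝ} : pt x ξ ∈ unitBall d ↔ ‖x‖ ^ 2 + ξ ^ 2 ≤ 1 := by
  rw [unitBall, mem_closedBall_zero_iff, ← norm_sq_pt, sq_le_one_iff₀ (norm_nonneg _)]

lemma frontier_unitBall : frontier (unitBall d) = Metric.sphere 0 1 :=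
  frontier_closedBall 0 one_ne_zero

lemma pt_mem_frontier_unitBall {x : Rd d} {ξ : ℝ} :
    pt x ξ ∈ frontier (unitBall d) ↔ ‖x‖ ^ 2 + ξ ^ 2 = 1 := by
  rw [frontier_unitBall, mem_sphere_zero_iff_norm, ← norm_sq_pt,
    pow_eq_one_iff_of_nonneg (norm_nonneg _) two_ne_zero]

lemma ballHeight_eq_sqrt (x : Rd d) : ballHeight x = √(1 - ‖x‖ ^ 2) := by
  unfold ballHeight
  split_ifs with h
  · rfl
  · rw [Real.sqrt_eq_zero_of_nonpos]
    nlinarith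

lemma ballHeight_nonneg (x : Rd d) : 0 ≤ ballHeight x := by
  rw [ballHeight_eq_sqrt]; positivity

lemma continuous_ballHeight : Continuous (ballHeight : Rd d → ℝ) := by
  simp_rw [funext ballHeight_eq_sqrt]; fun_prop

lemma ballHeight_sq {x : Rd d} (hx : ‖x‖ ≤ 1) : ballHeight x ^ 2 = 1 - ‖x‖ ^ 2 := by
  rw [ballHeight_eq_sqrt, Real.sq_sqrt]
  nlinarith [norm_nonneg x]

lemma ballHeight_pos_iff {x : Rd d} : 0 < ballHeight x ↔ ‖x‖ < 1 := by
  rw [ballHeight_eq_sqrt, Real.sqrt_pos, sub_pos, sq_lt_one_iff₀ (norm_nonneg _)]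

lemma ballHeight_eq_zero {x : Rd d} (hx : 1 ≤ ‖x‖) : ballHeight x = 0 :=
  le_antisymm (not_lt.1 fun h => (ballHeight_pos_iff.1 h).not_ge hx) (ballHeight_nonneg x)

lemma ballHeight_eq_abs {x : Rd d} {ξ : ℝ} (h : ‖x‖ ^ 2 + ξ ^ 2 = 1) : ballHeight x = |ξ| := by
  rw [ballHeight_eq_sqrt, ← Real.sqrt_sq_eq_abs]
  congr 1; linarith

lemma norm_le_one_of_sq_add_sq_le {x : Rd d} {ξ : ℝ} (h : ‖x‖ ^ 2 + ξ ^ 2 ≤ 1) : ‖x‖ ≤ 1 := by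
  rw [← sq_le_one_iff₀ (norm_nonneg _)]; nlinarith [sq_nonneg ξ]

lemma pt_mem_unitBall_iff_abs_le {x : Rd d} {ξ : ℝ} (hx : ‖x‖ ≤ 1) :
    pt x ξ ∈ unitBall d ↔ |ξ| ≤ ballHeight x := by
  rw [pt_mem_unitBall, ← abs_of_nonneg (ballHeight_nonneg x), ← sq_le_sq, ballHeight_sq hx]
  constructor <;> intro h <;> linarith

/-- The region between the graphs of `-g` and `g`. -/
def graphBody (g : Rd d → ℝ) : Set (RdOne d) := {z | |last z| ≤ g (proj z)}

lemma mem_graphBody {g : Rd d → ℝ} {z : RdOne d} : z ∈ graphBody g ↔ |last z| ≤ g (proj z) :=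
  Iff.rfl

lemma pt_mem_graphBody {g : Rd d → ℝ} {x : Rd d} {ξ : ℝ} : pt x ξ ∈ graphBody g ↔ |ξ| ≤ g x := by
  rw [mem_graphBody, proj_pt, last_pt]

lemma unitBall_subset_graphBody_iff {g : Rd d → ℝ} (hg : ∀ x, 0 ≤ g x) :
    unitBall d ⊆ graphBody g ↔ ∀ x, ballHeight x ≤ g x := by
  constructor
  · intro h x
    rcases le_or_gt ‖x‖ 1 with hx | hx
    · have : pt x (ballHeight x) ∈ unitBall d := by
        rw [pt_mem_unitBall_iff_abs_le hx, abs_of_nonneg (ballHeight_nonneg x)]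
      have := h this
      rwa [pt_mem_graphBody, abs_of_nonneg (ballHeight_nonneg x)] at this
    · rw [ballHeight_eq_zero hx.le]; exact hg x
  · intro h z hz
    rw [← pt_proj_last z] at hz
    have h1 := (pt_mem_unitBall_iff_abs_le (norm_le_one_of_sq_add_sq_le (pt_mem_unitBall.1 hz))).1 hz
    exact h1.trans (h _)

end Coordinates

/-! ### Affine images of the ball under arbitrary matrices -/

section AffineBall

variable {ι : Type*} [Fintype ι]

lemma mem_affineBall {A : Matrix ι ι ℝ} {a y : EuclideanSpace ℝ ι} :
    y ∈ affineBall A a ↔ ∃ z : EuclideanSpace ℝ ι, ‖z‖ ≤ 1 ∧ WithLp.toLp 2 (A *ᵥ z.ofLp) + a = y := by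
  simp [affineBall]

lemma affineBall_one_zero [DecidableEq ι] :
    affineBall (1 : Matrix ι ι ℝ) 0 = Metric.closedBall 0 1 := by
  ext y
  rw [mem_affineBall]
  simp

lemma volume_affineBall [DecidableEq ι] (A : Matrix ι ι ℝ) (a : EuclideanSpace ℝ ι) :
    volume (affineBall A a) =
      ENNReal.ofReal |A.det| * volume (Metric.closedBall (0 : EuclideanSpace ℝ ι) 1) := by
  have h : affineBall A a =
      (fun y => y + a) '' (Matrix.toEuclideanLin A '' Metric.closedBall 0 1) := by
    rw [image_image]; rfl
  have hdet : LinearMap.det (Matrix.toEuclideanLin A) = A.det := by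
    rw [Matrix.toEuclideanLin_eq_toLin_orthonormal, LinearMap.det_toLin]
  rw [h, image_add_right, measure_preimage_add_right, Measure.addHaar_image_linearMap, hdet]

/-- `A⁻¹ L` is orthogonal, so it maps the unit ball onto itself. This allows the symmetric matrix of
an ellipsoid to be replaced by a triangular factor. -/
lemma affineBall_eq_of_mul_transpose_eq [DecidableEq ι] {A L : Matrix ι ι ℝ} (hA : IsUnit A.det)
    (h : L * Lᵀ = A * Aᵀ) (a : EuclideanSpace ℝ ι) : affineBall L a = affineBall A a := by
  have hOO : (A⁻¹ * L) * (A⁻¹ * L)ᵀ = 1 := by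
    rw [Matrix.transpose_mul, Matrix.mul_assoc, ← Matrix.mul_assoc L, h, Matrix.mul_assoc,
      ← Matrix.transpose_mul, Matrix.nonsing_inv_mul _ hA, Matrix.transpose_one, Matrix.mul_one,
      Matrix.nonsing_inv_mul _ hA]
  have hL : L = A * (A⁻¹ * L) := by
    rw [← Matrix.mul_assoc, Matrix.mul_nonsing_inv _ hA, Matrix.one_mul]
  generalize A⁻¹ * L = O at hOO hL
  have hOO' : Oᵀ * O = 1 := mul_eq_one_comm.1 hOO
  have key : ∀ Q : Matrix ι ι ℝ, Qᵀ * Q = 1 → ∀ z : EuclideanSpace ℝ ι,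
      ‖WithLp.toLp 2 (Q *ᵥ z.ofLp)‖ = ‖z‖ := by
    intro Q hQ z
    rw [← sq_eq_sq₀ (norm_nonneg _) (norm_nonneg _), ← real_inner_self_eq_norm_sq,
      ← real_inner_self_eq_norm_sq, EuclideanSpace.inner_eq_star_dotProduct,
      EuclideanSpace.inner_eq_star_dotProduct]
    simp only [star_trivial]
    rw [Matrix.dotProduct_mulVec, Matrix.vecMul_mulVec, hQ, Matrix.vecMul_one]
  ext y
  rw [mem_affineBall, mem_affineBall]
  constructor
  · rintro ⟨z, hz, rfl⟩
    refine ⟨WithLp.toLp 2 (O *ᵥ z.ofLp), by rwa [key O hOO'], ?_⟩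
    simp only [Matrix.mulVec_mulVec, ← hL]
  · rintro ⟨z, hz, rfl⟩
    refine ⟨WithLp.toLp 2 (Oᵀ *ᵥ z.ofLp), by rwa [key Oᵀ (by simpa using hOO)], ?_⟩
    simp only [Matrix.mulVec_mulVec, hL]
    rw [Matrix.mul_assoc, hOO, Matrix.mul_one]

end AffineBall

/-! ### Block matrices, `d`-symmetric ellipsoids and their `s`-volume -/

section Volume

variable {d : ℕ}

/-- The lower triangular block matrix with rows `(P, 0)` and `(w, r)`. -/
def lowerBlock (P : Matrix (Fin d) (Fin d) ℝ) (w : Rd d) (r : ℝ) :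
    Matrix (Fin d ⊕ Unit) (Fin d ⊕ Unit) ℝ :=
  Matrix.fromBlocks P 0 (Matrix.of fun _ j => w j) (Matrix.diagonal fun _ => r)

lemma oplus_eq_lowerBlock (A : Matrix (Fin d) (Fin d) ℝ) (α : ℝ) :
    oplus A α = lowerBlock A 0 α := by
  unfold oplus lowerBlock
  congr 1

lemma det_lowerBlock (P : Matrix (Fin d) (Fin d) ℝ) (w : Rd d) (r : ℝ) :
    (lowerBlock P w r).det = P.det * r := by
  rw [lowerBlock, Matrix.det_fromBlocks_zero₁₂, Matrix.det_diagonal]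
  simp

lemma oplus_one_one : (oplus 1 1 : Matrix (Fin d ⊕ Unit) (Fin d ⊕ Unit) ℝ) = 1 := by
  rw [oplus, Matrix.diagonal_one, Matrix.fromBlocks_one]

lemma lowerBlock_mulVec_pt (P : Matrix (Fin d) (Fin d) ℝ) (w : Rd d) (r : ℝ) (x : Rd d) (ξ : ℝ) :
    WithLp.toLp 2 (lowerBlock P w r *ᵥ (pt x ξ).ofLp) =
      pt (Matrix.toEuclideanLin P x) (inner ℝ w x + r * ξ) := by
  ext i
  rcases i with i | i
  · simp [lowerBlock, pt, Matrix.fromBlocks_mulVec, Matrix.toLpLin_apply]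
  · simp [lowerBlock, pt, Matrix.fromBlocks_mulVec, EuclideanSpace.inner_eq_star_dotProduct]
    rw [dotProduct_comm]
    rfl

lemma mem_affineBall_lowerBlock {P : Matrix (Fin d) (Fin d) ℝ} {w : Rd d} {r : ℝ} {a : Rd d}
    {t : ℝ} {z : RdOne d} :
    z ∈ affineBall (lowerBlock P w r) (pt a t) ↔ ∃ (x : Rd d) (ξ : ℝ), ‖x‖ ^ 2 + ξ ^ 2 ≤ 1 ∧
      pt (Matrix.toEuclideanLin P x + a) (inner ℝ w x + r * ξ + t) = z := by
  rw [mem_affineBall]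
  constructor
  · rintro ⟨y, hy, rfl⟩
    refine ⟨proj y, last y, ?_, ?_⟩
    · rw [← pt_mem_unitBall, pt_proj_last]
      simpa [unitBall] using hy
    · rw [← pt_add, ← lowerBlock_mulVec_pt, pt_proj_last]
  · rintro ⟨x, ξ, h, rfl⟩
    refine ⟨pt x ξ, by simpa [unitBall] using pt_mem_unitBall.2 h, ?_⟩
    rw [lowerBlock_mulVec_pt, pt_add]

lemma mem_body_oplus {A : Matrix (Fin d) (Fin d) ℝ} {α : ℝ} {a : Rd d} {z : RdOne d} :
    z ∈ body (oplus A α, a) ↔ ∃ (x : Rd d) (ξ : ℝ), ‖x‖ ^ 2 + ξ ^ 2 ≤ 1 ∧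
      pt (Matrix.toEuclideanLin A x + a) (α * ξ) = z := by
  simp only [body]
  rw [oplus_eq_lowerBlock, mem_affineBall_lowerBlock]
  simp

lemma body_one_zero : body ((1 : Matrix (Fin d ⊕ Unit) (Fin d ⊕ Unit) ℝ), (0 : Rd d)) =
    unitBall d := by
  rw [body, pt_zero_zero, affineBall_one_zero, unitBall]

lemma isDSymmetricEllipsoid_unitBall : IsDSymmetricEllipsoid (unitBall d) :=
  ⟨(1, 0), ⟨1, 1, Matrix.PosDef.one, one_pos, oplus_one_one.symm⟩, body_one_zero.symm⟩

lemma isEllipsoid_unitBall : IsEllipsoid (unitBall d) :=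
  ⟨1, 0, Matrix.PosDef.one, affineBall_one_zero.symm⟩

lemma posDef_oplus {A : Matrix (Fin d) (Fin d) ℝ} {α : ℝ} (hA : A.PosDef) (hα : 0 < α) :
    (oplus A α).PosDef := by
  refine Matrix.PosDef.of_dotProduct_mulVec_pos ?_ ?_
  · rw [oplus, Matrix.isHermitian_fromBlocks_iff]
    refine ⟨hA.1, by simp, by simp, ?_⟩
    rw [Matrix.isHermitian_diagonal_iff]
    intro i; simp [IsSelfAdjoint]
  · intro x hx
    obtain ⟨y, c, rfl⟩ : ∃ (y : Fin d → ℝ) (c : Unit → ℝ), Sum.elim y c = x :=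
      ⟨x ∘ Sum.inl, x ∘ Sum.inr, Sum.elim_comp_inl_inr x⟩
    have h1 : star (Sum.elim y c) ⬝ᵥ oplus A α *ᵥ Sum.elim y c = y ⬝ᵥ A *ᵥ y + α * c () ^ 2 := by
      simp [oplus, Matrix.fromBlocks_mulVec]
      exact Or.inl (by ring)
    rw [h1]
    have h2 : 0 ≤ α * c () ^ 2 := by positivity
    by_cases hy : y = 0
    · have hc : c () ≠ 0 := by
        rintro hc
        apply hx
        funext i
        rcases i with i | i
        · simp [hy]
        · simpa using hc
      subst hy
      simp only [Matrix.mulVec_zero, dotProduct_zero, zero_add]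
      positivity
    · have := hA.dotProduct_mulVec_pos hy
      simp only [star_trivial] at this
      linarith

lemma IsDSymmetricEllipsoid.isEllipsoid {E : Set (RdOne d)} (h : IsDSymmetricEllipsoid E) :
    IsEllipsoid E := by
  obtain ⟨⟨M, a⟩, ⟨A, α, hA, hα, rfl⟩, rfl⟩ := h
  exact ⟨_, _, posDef_oplus hA hα, rfl⟩

lemma toEuclideanLin_inv_apply {A : Matrix (Fin d) (Fin d) ℝ} (hA : IsUnit A.det) (x : Rd d) :
    Matrix.toEuclideanLin A⁻¹ (Matrix.toEuclideanLin A x) = x := by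
  simp [Matrix.toLpLin_apply, Matrix.mulVec_mulVec, Matrix.nonsing_inv_mul _ hA]

lemma toEuclideanLin_apply_inv {A : Matrix (Fin d) (Fin d) ℝ} (hA : IsUnit A.det) (x : Rd d) :
    Matrix.toEuclideanLin A (Matrix.toEuclideanLin A⁻¹ x) = x := by
  simp [Matrix.toLpLin_apply, Matrix.mulVec_mulVec, Matrix.mul_nonsing_inv _ hA]

lemma volume_fiber_body {A : Matrix (Fin d) (Fin d) ℝ} {α : ℝ} (hA : A.PosDef) (hα : 0 < α)
    (a x : Rd d) :
    volume {ξ : ℝ | pt x ξ ∈ body (oplus A α, a)} / 2 =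
      ENNReal.ofReal (α * ballHeight (Matrix.toEuclideanLin A⁻¹ (x - a))) := by
  have hu : IsUnit A.det := hA.det_pos.ne'.isUnit
  obtain ⟨v, rfl⟩ : ∃ v, Matrix.toEuclideanLin A v + a = x :=
    ⟨Matrix.toEuclideanLin A⁻¹ (x - a), by rw [toEuclideanLin_apply_inv hu]; abel⟩
  rw [add_sub_cancel_right, toEuclideanLin_inv_apply hu]
  have hmem : ∀ ξ, pt (Matrix.toEuclideanLin A v + a) ξ ∈ body (oplus A α, a) ↔
      pt v (ξ / α) ∈ unitBall d := by
    intro ξ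
    rw [mem_body_oplus, pt_mem_unitBall]
    constructor
    · rintro ⟨y, η, h, he⟩
      obtain ⟨h1, h2⟩ := pt_inj.1 he
      have hy : y = v := by
        have := congrArg (Matrix.toEuclideanLin A⁻¹) (add_right_cancel h1)
        rwa [toEuclideanLin_inv_apply hu, toEuclideanLin_inv_apply hu] at this
      subst hy
      rw [← h2, mul_div_cancel_left₀ _ hα.ne']
      exact h
    · intro h
      exact ⟨v, ξ / α, h, by rw [mul_div_cancel₀ _ hα.ne']⟩
  rcases le_or_gt ‖v‖ 1 with hv | hv
  · have : {ξ : ℝ | pt (Matrix.toEuclideanLin A v + a) ξ ∈ body (oplus A α, a)} =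
        Icc (-(α * ballHeight v)) (α * ballHeight v) := by
      ext ξ
      rw [mem_ofPred_eq, hmem, pt_mem_unitBall_iff_abs_le hv, abs_div, abs_of_pos hα,
        div_le_iff₀ hα, mem_Icc, abs_le, mul_comm α]
    rw [this, Real.volume_Icc, show α * ballHeight v - -(α * ballHeight v) =
      α * ballHeight v * 2 by ring, ENNReal.ofReal_mul' zero_le_two, ENNReal.ofReal_ofNat,
      ENNReal.mul_div_cancel_right two_ne_zero ENNReal.ofNat_ne_top]
  · have : {ξ : ℝ | pt (Matrix.toEuclideanLin A v + a) ξ ∈ body (oplus A α, a)} = ∅ := by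
      ext ξ
      rw [mem_ofPred_eq, hmem]
      simp only [mem_empty_iff_false, iff_false]
      intro h
      exact (norm_le_one_of_sq_add_sq_le (pt_mem_unitBall.1 h)).not_gt hv
    rw [this, ballHeight_eq_zero hv.le]
    simp

lemma volume_fiber_unitBall (x : Rd d) :
    volume {ξ : ℝ | pt x ξ ∈ unitBall d} / 2 = ENNReal.ofReal (ballHeight x) := by
  rw [← body_one_zero, ← oplus_one_one, volume_fiber_body Matrix.PosDef.one one_pos]
  simp

lemma sVolume_unitBall {s : ℝ} (hs : 0 < s) :
    sVolume s (unitBall d) = ∫⁻ x : Rd d, ENNReal.ofReal (ballHeight x ^ s) := by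
  unfold sVolume
  simp_rw [volume_fiber_unitBall, ENNReal.ofReal_rpow_of_nonneg (ballHeight_nonneg _) hs.le]

lemma sMarginal_unitBall {s : ℝ} (hs : 0 < s) :
    sMarginal s (unitBall d) = volume.withDensity fun x => ENNReal.ofReal (ballHeight x ^ s) := by
  unfold sMarginal
  simp_rw [volume_fiber_unitBall, ENNReal.ofReal_rpow_of_nonneg (ballHeight_nonneg _) hs.le]

lemma sVolume_eq_sMarginal_univ (s : ℝ) (C : Set (RdOne d)) :
    sVolume s C = sMarginal s C univ := by
  rw [sMarginal, withDensity_apply _ MeasurableSet.univ, Measure.restrict_univ, sVolume]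

lemma sVolume_unitBall_ne_top {s : ℝ} (hs : 0 < s) : sVolume s (unitBall d) ≠ ⊤ := by
  rw [sVolume_unitBall hs]
  have : ∀ x : Rd d, ENNReal.ofReal (ballHeight x ^ s) ≤
      (Metric.closedBall (0 : Rd d) 1).indicator 1 x := by
    intro x
    by_cases hx : x ∈ Metric.closedBall (0 : Rd d) 1
    · rw [indicator_of_mem hx, Pi.one_apply, ENNReal.ofReal_le_one]
      refine Real.rpow_le_one (ballHeight_nonneg x) ?_ hs.le
      rw [ballHeight_eq_sqrt, Real.sqrt_le_one]
      nlinarith [norm_nonneg x]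
    · rw [indicator_of_notMem hx, ballHeight_eq_zero, Real.zero_rpow hs.ne', ENNReal.ofReal_zero]
      rw [mem_closedBall_zero_iff, not_le] at hx
      exact hx.le
  refine ((lintegral_mono this).trans_lt ?_).ne
  rw [lintegral_indicator_one Metric.isClosed_closedBall.measurableSet]
  exact measure_closedBall_lt_top

lemma sVolume_unitBall_ne_zero {s : ℝ} (hs : 0 < s) : sVolume s (unitBall d) ≠ 0 := by
  rw [sVolume_unitBall hs]
  refine ((lintegral_pos_iff_support ?_).2 ?_).ne'
  · exact ENNReal.measurable_ofReal.comp
      ((continuous_ballHeight.rpow_const fun _ => Or.inr hs.le).measurable)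
  · refine (Metric.measure_ball_pos volume (0 : Rd d) one_pos).trans_le (measure_mono ?_)
    intro x hx
    rw [Function.mem_support, Ne, ENNReal.ofReal_eq_zero, not_le]
    exact Real.rpow_pos_of_pos (ballHeight_pos_iff.2 (by simpa using hx)) s

/-- The section over `x` has half-length `α h(A⁻¹(x - a))`, so the change of variables `x = A v + a`
produces the factor `α^s det A`. Comparing `s`-volumes thus becomes comparing this number with `1`.
-/
lemma sVolume_body {s : ℝ} (hs : 0 < s) {A : Matrix (Fin d) (Fin d) ℝ} {α : ℝ} (hA : A.PosDef)
    (hα : 0 < α) (a : Rd d) :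
    sVolume s (body (oplus A α, a)) = ENNReal.ofReal (α ^ s * A.det) * sVolume s (unitBall d) := by
  have hdet := hA.det_pos
  have hdet' : LinearMap.det (Matrix.toEuclideanLin A⁻¹) = A.det⁻¹ := by
    rw [Matrix.toEuclideanLin_eq_toLin_orthonormal, LinearMap.det_toLin, Matrix.det_nonsing_inv,
      Ring.inverse_eq_inv']
  have hmeas : Measurable fun x : Rd d => ENNReal.ofReal (ballHeight x ^ s) :=
    ENNReal.measurable_ofReal.comp
      ((continuous_ballHeight.rpow_const fun _ => Or.inr hs.le).measurable)
  have h1 : ∀ x : Rd d, (volume {ξ : ℝ | pt x ξ ∈ body (oplus A α, a)} / 2) ^ s =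
      ENNReal.ofReal (α ^ s) *
        ENNReal.ofReal (ballHeight (Matrix.toEuclideanLin A⁻¹ (x - a)) ^ s) := by
    intro x
    rw [volume_fiber_body hA hα, ENNReal.ofReal_rpow_of_nonneg
      (mul_nonneg hα.le (ballHeight_nonneg _)) hs.le,
      Real.mul_rpow hα.le (ballHeight_nonneg _), ENNReal.ofReal_mul (by positivity)]
  rw [sVolume]
  simp_rw [h1]
  rw [lintegral_const_mul' _ _ ENNReal.ofReal_ne_top,
    lintegral_sub_right_eq_self
      (fun x => ENNReal.ofReal (ballHeight (Matrix.toEuclideanLin A⁻¹ x) ^ s)) a,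
    ← lintegral_map (f := fun x => ENNReal.ofReal (ballHeight x ^ s)) hmeas
      (LinearMap.continuous_of_finiteDimensional _).measurable,
    Measure.map_linearMap_addHaar_eq_smul_addHaar _ (by rw [hdet']; positivity), hdet', inv_inv,
    abs_of_pos hdet, lintegral_smul_measure, ← sVolume_unitBall hs, smul_eq_mul, ← mul_assoc,
    ← ENNReal.ofReal_mul (by positivity)]

lemma ofReal_mul_le_self_iff {V : ℝ≥0∞} (h0 : V ≠ 0) (ht : V ≠ ⊤) {c : ℝ} :
    ENNReal.ofReal c * V ≤ V ↔ c ≤ 1 := by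
  rw [← ENNReal.ofReal_le_one]
  conv_lhs => rhs; rw [← one_mul V]
  rw [ENNReal.mul_le_mul_iff_left h0 ht]

lemma ofReal_mul_eq_self_iff {V : ℝ≥0∞} (h0 : V ≠ 0) (ht : V ≠ ⊤) {c : ℝ} :
    ENNReal.ofReal c * V = V ↔ c = 1 := by
  rw [← ENNReal.ofReal_eq_one]
  conv_lhs => rhs; rw [← one_mul V]
  rw [ENNReal.mul_left_inj h0 ht]

end Volume

/-! ### Bounds on a log-concave function from a contact point -/

section Contact

variable {d : ℕ}

lemma IsLogConcave.rpow {f : Rd d → ℝ} (hf : IsLogConcave f) {p : ℝ} (hp : 0 ≤ p) :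
    IsLogConcave fun x => f x ^ p := by
  refine ⟨fun x => Real.rpow_nonneg (hf.1 x) p, fun x y t h0 h1 => ?_⟩
  have := Real.rpow_le_rpow (mul_nonneg (Real.rpow_nonneg (hf.1 x) _)
    (Real.rpow_nonneg (hf.1 y) _)) (hf.2 x y t h0 h1) hp
  refine le_trans (le_of_eq ?_) this
  rw [Real.mul_rpow (Real.rpow_nonneg (hf.1 x) _) (Real.rpow_nonneg (hf.1 y) _),
    ← Real.rpow_mul (hf.1 x), ← Real.rpow_mul (hf.1 y), ← Real.rpow_mul (hf.1 x),
    ← Real.rpow_mul (hf.1 y), mul_comm p, mul_comm p]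

lemma IsLogConcave.div_const {f : Rd d → ℝ} (hf : IsLogConcave f) {c : ℝ} (hc : 0 < c) :
    IsLogConcave fun x => f x / c := by
  refine ⟨fun x => div_nonneg (hf.1 x) hc.le, fun x y t h0 h1 => ?_⟩
  rw [Real.div_rpow (hf.1 x) hc.le, Real.div_rpow (hf.1 y) hc.le, div_mul_div_comm,
    ← Real.rpow_add hc, sub_add_cancel, Real.rpow_one]
  exact div_le_div_of_nonneg_right (hf.2 x y t h0 h1) hc.le

/-- If `z` lies outside the body, then `proj z` lies between `x` and a point `y` behind it, and
log-concavity with `h(y) ≤ g(y)` bounds `h(y) g(x)^τ` by a power of `|last z|`. That inequality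
involves only continuous functions of `z`, so it passes to the closure of the complement, with no
continuity of `g` at `u`. The next two bounds come from choosing `τ`. -/
lemma ballHeight_mul_rpow_le_of_mem_frontier {g : Rd d → ℝ} (hg : IsLogConcave g)
    (hB : ∀ x, ballHeight x ≤ g x) {u : Rd d} {ξ : ℝ} (h1 : ‖u‖ ^ 2 + ξ ^ 2 = 1)
    (h2 : pt u ξ ∈ frontier (graphBody g)) (x : Rd d) {τ : ℝ} (hτ : 0 < τ) :
    ballHeight (u - τ • (x - u)) * g x ^ τ ≤ ballHeight u ^ (1 + τ) := by
  have hτ1 : 0 < 1 + τ := by linarith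
  have hclosed : IsClosed {z : RdOne d |
      ballHeight (proj z - τ • (x - proj z)) * g x ^ τ ≤ |last z| ^ (1 + τ)} := by
    refine isClosed_le ?_ ?_
    · refine (continuous_ballHeight.comp ?_).mul continuous_const
      exact continuous_proj.sub ((continuous_const.sub continuous_proj).const_smul τ)
    · exact continuous_last.abs.rpow_const fun _ => Or.inr hτ1.le
  have hsub : (graphBody g)ᶜ ⊆ {z : RdOne d |
      ballHeight (proj z - τ • (x - proj z)) * g x ^ τ ≤ |last z| ^ (1 + τ)} := by
    intro z hz
    rw [mem_compl_iff, mem_graphBody, not_le] at hz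
    rw [mem_ofPred_eq]
    -- `y` is the point on the line through `x` and `proj z` for which `proj z` divides `[y, x]`
    -- with weight `τ / (1 + τ)` at `x`; raising to the power `1 + τ` clears the denominators.
    set y := proj z - τ • (x - proj z) with hy
    have ht0 : 0 < τ / (1 + τ) := by positivity
    have ht1 : τ / (1 + τ) < 1 := by rw [div_lt_one hτ1]; linarith
    have hlc := hg.2 y x (τ / (1 + τ)) ht0 ht1
    have hcomb : (1 - τ / (1 + τ)) • y + (τ / (1 + τ)) • x = proj z := by
      rw [hy]
      match_scalars <;> field_simp <;> ring
    rw [hcomb] at hlc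
    have hpow := Real.rpow_le_rpow (mul_nonneg (Real.rpow_nonneg (hg.1 y) _)
      (Real.rpow_nonneg (hg.1 x) _)) (hlc.trans hz.le) hτ1.le
    rw [Real.mul_rpow (Real.rpow_nonneg (hg.1 y) _) (Real.rpow_nonneg (hg.1 x) _),
      ← Real.rpow_mul (hg.1 y), ← Real.rpow_mul (hg.1 x), div_mul_cancel₀ _ hτ1.ne',
      show (1 - τ / (1 + τ)) * (1 + τ) = 1 by field_simp; ring, Real.rpow_one] at hpow
    exact (mul_le_mul_of_nonneg_right (hB y) (Real.rpow_nonneg (hg.1 x) _)).trans hpow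
  have hmem : pt u ξ ∈ closure (graphBody g)ᶜ := by
    rw [frontier_eq_closure_inter_closure] at h2
    exact h2.2
  have := closure_minimal hsub hclosed hmem
  rw [mem_ofPred_eq, proj_pt, last_pt] at this
  rwa [ballHeight_eq_abs h1]

lemma norm_sub_smul_sq (u w : Rd d) (τ : ℝ) :
    ‖u - τ • w‖ ^ 2 = ‖u‖ ^ 2 - 2 * τ * inner ℝ u w + τ ^ 2 * ‖w‖ ^ 2 := by
  rw [norm_sub_sq_real, inner_smul_right, norm_smul, mul_pow, Real.norm_eq_abs, sq_abs]
  ring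

lemma hasDerivAt_ballHeight {u : Rd d} (hu : ‖u‖ < 1) (w : Rd d) :
    HasDerivAt (fun τ : ℝ => ballHeight (u - τ • w)) (inner ℝ u w / ballHeight u) 0 := by
  have hpos := ballHeight_pos_iff.2 hu
  have hq : HasDerivAt (fun τ : ℝ => 1 - (‖u‖ ^ 2 - 2 * τ * inner ℝ u w + τ ^ 2 * ‖w‖ ^ 2))
      (2 * inner ℝ u w) 0 := by
    have h := (((((hasDerivAt_id (0 : ℝ)).const_mul 2).mul_const (inner ℝ u w)).const_sub
      (‖u‖ ^ 2)).add (((hasDerivAt_id (0 : ℝ)).pow 2).mul_const (‖w‖ ^ 2))).const_sub 1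
    refine h.congr_deriv ?_
    simp
  have h := hq.sqrt (by
    have := ballHeight_sq hu.le
    have : 0 < ballHeight u ^ 2 := by positivity
    simp; nlinarith)
  have he : (fun τ : ℝ => ballHeight (u - τ • w)) =
      fun τ => √(1 - (‖u‖ ^ 2 - 2 * τ * inner ℝ u w + τ ^ 2 * ‖w‖ ^ 2)) := by
    funext τ
    rw [ballHeight_eq_sqrt, norm_sub_smul_sq]
  rw [he]
  refine h.congr_deriv ?_
  have h0 : √(1 - (‖u‖ ^ 2 - 2 * 0 * inner ℝ u w + 0 ^ 2 * ‖w‖ ^ 2)) = ballHeight u := by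
    rw [ballHeight_eq_sqrt]; simp
  rw [h0]
  field_simp

/-- Take logarithms in the previous inequality, divide by `τ` and let `τ → 0+`: the slope of `-log
h` at `u` in the direction `-(x - u)` bounds `log g(x) - log h(u)`. -/
lemma le_mul_exp_of_mem_frontier {g : Rd d → ℝ} (hg : IsLogConcave g)
    (hB : ∀ x, ballHeight x ≤ g x) {u : Rd d} {ξ : ℝ} (h1 : ‖u‖ ^ 2 + ξ ^ 2 = 1)
    (h2 : pt u ξ ∈ frontier (graphBody g)) (hu : ‖u‖ < 1) (x : Rd d) :
    g x ≤ ballHeight u * Real.exp (-inner ℝ u (x - u) / ballHeight u ^ 2) := by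
  have hpos := ballHeight_pos_iff.2 hu
  rcases (hg.1 x).eq_or_lt with h0 | h0
  · rw [← h0]; positivity
  have hd : HasDerivAt (fun τ : ℝ => -Real.log (ballHeight (u - τ • (x - u))))
      (-inner ℝ u (x - u) / ballHeight u ^ 2) 0 := by
    have hlog := ((hasDerivAt_ballHeight hu (x - u)).log (by simpa using hpos.ne')).neg
    refine hlog.congr_deriv ?_
    simp only [zero_smul, sub_zero]
    field_simp
  have hlim := hd.tendsto_slope_zero_right
  simp only [zero_add, zero_smul, sub_zero, smul_eq_mul] at hlim
  have hev : ∀ᶠ τ : ℝ in 𝓝[>] 0, 0 < ballHeight (u - τ • (x - u)) := by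
    have hc : Continuous fun τ : ℝ => ballHeight (u - τ • (x - u)) :=
      continuous_ballHeight.comp (by fun_prop)
    refine nhdsWithin_le_nhds (hc.continuousAt.eventually_const_lt ?_)
    simpa using hpos
  have hle : Real.log (g x) - Real.log (ballHeight u) ≤
      -inner ℝ u (x - u) / ballHeight u ^ 2 := by
    refine ge_of_tendsto hlim ?_
    filter_upwards [hev, self_mem_nhdsWithin] with τ hτ hτ0
    rw [mem_Ioi] at hτ0
    have hineq := Real.log_le_log (mul_pos hτ (Real.rpow_pos_of_pos h0 τ))
      (ballHeight_mul_rpow_le_of_mem_frontier hg hB h1 h2 x hτ0)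
    rw [Real.log_mul hτ.ne' (Real.rpow_pos_of_pos h0 τ).ne', Real.log_rpow h0,
      Real.log_rpow hpos] at hineq
    rw [inv_mul_eq_div, le_div_iff₀ hτ0]
    linarith
  calc g x = Real.exp (Real.log (g x)) := (Real.exp_log h0).symm
    _ ≤ Real.exp (Real.log (ballHeight u) + -inner ℝ u (x - u) / ballHeight u ^ 2) :=
        Real.exp_le_exp.2 (by linarith)
    _ = _ := by rw [Real.exp_add, Real.exp_log hpos]

/-- Here `h(u) = 0`, so the general inequality says that `g(x) > 0` excludes `h(u - τ(x - u)) > 0`.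
If `⟨u, x⟩ > 1`, moving from `u` away from `x` enters the open ball, a contradiction. -/
lemma inner_le_one_of_mem_frontier {g : Rd d → ℝ} (hg : IsLogConcave g)
    (hB : ∀ x, ballHeight x ≤ g x) {u : Rd d} {ξ : ℝ} (h1 : ‖u‖ ^ 2 + ξ ^ 2 = 1)
    (h2 : pt u ξ ∈ frontier (graphBody g)) (hu : ‖u‖ = 1) {x : Rd d} (hx : 0 < g x) :
    inner ℝ u x ≤ 1 := by
  by_contra! hlt
  have hp : 0 < inner ℝ u (x - u) := by
    rw [inner_sub_right, real_inner_self_eq_norm_sq, hu]; linarith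
  have hm : 0 < ‖x - u‖ ^ 2 := by
    have : x - u ≠ 0 := by
      intro h; rw [h, inner_zero_right] at hp; exact lt_irrefl _ hp
    positivity
  set p := inner ℝ u (x - u)
  -- This `τ` minimizes `‖u - τ(x - u)‖`.
  have hτ : 0 < p / ‖x - u‖ ^ 2 := by positivity
  have hineq := ballHeight_mul_rpow_le_of_mem_frontier hg hB h1 h2 x hτ
  rw [ballHeight_eq_zero hu.ge, Real.zero_rpow (by positivity)] at hineq
  refine hineq.not_gt (mul_pos (ballHeight_pos_iff.2 ?_) (Real.rpow_pos_of_pos hx _))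
  rw [← sq_lt_one_iff₀ (norm_nonneg _), norm_sub_smul_sq, hu]
  have : 1 ^ 2 - 2 * (p / ‖x - u‖ ^ 2) * p + (p / ‖x - u‖ ^ 2) ^ 2 * ‖x - u‖ ^ 2 =
      1 - p ^ 2 / ‖x - u‖ ^ 2 := by
    field_simp; ring
  change 1 ^ 2 - 2 * (p / ‖x - u‖ ^ 2) * p + (p / ‖x - u‖ ^ 2) ^ 2 * ‖x - u‖ ^ 2 < 1
  rw [this]
  have : 0 < p ^ 2 / ‖x - u‖ ^ 2 := by positivity
  linarith

lemma eq_ballHeight_of_mem_frontier {g : Rd d → ℝ} (hg : IsLogConcave g)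
    (hB : ∀ x, ballHeight x ≤ g x) {u : Rd d} {ξ : ℝ} (h1 : ‖u‖ ^ 2 + ξ ^ 2 = 1)
    (h2 : pt u ξ ∈ frontier (graphBody g)) (hu : ‖u‖ < 1) : g u = ballHeight u :=
  le_antisymm (by simpa using le_mul_exp_of_mem_frontier hg hB h1 h2 hu u) (hB u)

/-- The bounds at interior and equatorial contact points take one common form, linear in `T`, `a`
and `log r`, which can be summed against the weights. -/
lemma log_add_inner_le_of_mem_frontier {g : Rd d → ℝ} (hg : IsLogConcave g)
    (hB : ∀ x, ballHeight x ≤ g x) {u : Rd d} {ξ : ℝ} (h1 : ‖u‖ ^ 2 + ξ ^ 2 = 1)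
    (h2 : pt u ξ ∈ frontier (graphBody g)) (T : Rd d →ₗ[ℝ] Rd d) (a : Rd d) {r : ℝ} (hr : 0 < r)
    (hE : ∀ v, ‖v‖ ≤ 1 → r * ballHeight v ≤ g (T v + a)) :
    ξ ^ 2 * Real.log r + inner ℝ u (T u) + inner ℝ u a ≤ ‖u‖ ^ 2 := by
  have hu1 : ‖u‖ ≤ 1 := norm_le_one_of_sq_add_sq_le h1.le
  rcases hu1.eq_or_lt with hu | hu
  · have hξ : ξ ^ 2 = 0 := by rw [hu] at h1; linarith
    rw [hξ, zero_mul, zero_add, hu, one_pow]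
    -- On the equator `h(u) = 0` says nothing about `g(T u + a)`; at `ρ u` with `ρ < 1` the function
    -- `g` is positive at the image, and the half-space bound survives the limit `ρ → 1`.
    have hc : Continuous fun ρ : ℝ => inner ℝ u (T (ρ • u)) + inner ℝ u a := by
      simp only [map_smul]; fun_prop
    have hlim : Filter.Tendsto (fun ρ : ℝ => inner ℝ u (T (ρ • u)) + inner ℝ u a) (𝓝[<] 1)
        (𝓝 (inner ℝ u (T u) + inner ℝ u a)) := by
      have := hc.tendsto 1
      rw [one_smul] at this
      exact this.mono_left nhdsWithin_le_nhds
    refine le_of_tendsto hlim ?_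
    filter_upwards [Ioo_mem_nhdsLT (show (0 : ℝ) < 1 by norm_num)] with ρ hρ
    have hρu : ‖ρ • u‖ < 1 := by
      rw [norm_smul, hu, mul_one, Real.norm_eq_abs, abs_of_pos hρ.1]; exact hρ.2
    have hgp := (mul_pos hr (ballHeight_pos_iff.2 hρu)).trans_le (hE _ hρu.le)
    have := inner_le_one_of_mem_frontier hg hB h1 h2 hu hgp
    rwa [inner_add_right] at this
  · have hpos := ballHeight_pos_iff.2 hu
    have hle := (hE u hu.le).trans (le_mul_exp_of_mem_frontier hg hB h1 h2 hu (T u + a))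
    rw [mul_comm r, mul_le_mul_iff_right₀ hpos, ← Real.log_le_iff_le_exp hr,
      le_div_iff₀ (by positivity), ballHeight_eq_abs h1, sq_abs, inner_sub_right,
      inner_add_right, real_inner_self_eq_norm_sq] at hle
    linarith

end Contact

/-! ### The determinant estimate and its equality case -/

section Extremal

variable {d : ℕ}

/-- This is `log λ ≤ λ - 1` summed over the eigenvalues, with equality only if every eigenvalue is
`1`. -/
lemma log_det_le_trace_sub {n : Type*} [Fintype n] [DecidableEq n] {P : Matrix n n ℝ}
    (hP : P.PosDef) : Real.log P.det ≤ P.trace - Fintype.card n ∧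
      (Real.log P.det = P.trace - Fintype.card n → P = 1) := by
  have hpos := hP.eigenvalues_pos
  have hdet : Real.log P.det = ∑ i, Real.log (hP.1.eigenvalues i) := by
    rw [hP.1.det_eq_prod_eigenvalues, Real.log_prod]
    · simp
    · intro i _; exact (hpos i).ne'
  have htr : P.trace - Fintype.card n = ∑ i, (hP.1.eigenvalues i - 1) := by
    rw [hP.1.trace_eq_sum_eigenvalues]
    simp
  have hle : ∀ i ∈ Finset.univ, Real.log (hP.1.eigenvalues i) ≤ hP.1.eigenvalues i - 1 :=
    fun i _ => Real.log_le_sub_one_of_pos (hpos i)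
  rw [hdet, htr]
  refine ⟨Finset.sum_le_sum hle, fun h => ?_⟩
  have h1 : ∀ i, hP.1.eigenvalues i = 1 := by
    intro i
    by_contra hne
    have := (Finset.sum_eq_sum_iff_of_le hle).1 h i (Finset.mem_univ i)
    exact (Real.log_lt_sub_one_of_pos (hpos i) hne).ne this
  have h2 := hP.1.spectral_theorem
  rw [show (RCLike.ofReal ∘ hP.1.eigenvalues : n → ℝ) = fun _ => 1 by
    funext i; simp [h1 i], Matrix.diagonal_one, map_one] at h2
  exact h2

lemma inner_toEuclideanLin_eq_trace {n : Type*} [Fintype n] [DecidableEq n] (P : Matrix n n ℝ)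
    (x : EuclideanSpace ℝ n) : inner ℝ x (Matrix.toEuclideanLin P x) =
      (P * Matrix.vecMulVec x.ofLp x.ofLp).trace := by
  rw [Matrix.mul_vecMulVec, Matrix.trace_vecMulVec, EuclideanSpace.inner_eq_star_dotProduct]
  simp [Matrix.toLpLin_apply]

lemma sum_mul_inner_toEuclideanLin {n ι : Type*} [Fintype n] [DecidableEq n] [Fintype ι]
    (P : Matrix n n ℝ) {u : ι → EuclideanSpace ℝ n} {c : ι → ℝ} {S : Matrix n n ℝ}
    (h : ∑ i, c i • Matrix.vecMulVec (u i).ofLp (u i).ofLp = S) :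
    ∑ i, c i * inner ℝ (u i) (Matrix.toEuclideanLin P (u i)) = (P * S).trace := by
  simp_rw [inner_toEuclideanLin_eq_trace, ← h, Finset.mul_sum, Matrix.trace_sum, Matrix.mul_smul,
    Matrix.trace_smul, smul_eq_mul]

lemma sum_mul_inner_sq {n ι : Type*} [Fintype n] [DecidableEq n] [Fintype ι]
    {u : ι → EuclideanSpace ℝ n} {c : ι → ℝ} {S : Matrix n n ℝ}
    (h : ∑ i, c i • Matrix.vecMulVec (u i).ofLp (u i).ofLp = S) (a : EuclideanSpace ℝ n) :
    ∑ i, c i * inner ℝ (u i) a ^ 2 = a.ofLp ⬝ᵥ S *ᵥ a.ofLp := by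
  rw [← h, Matrix.sum_mulVec, dotProduct_sum]
  refine Finset.sum_congr rfl fun i _ => ?_
  rw [Matrix.smul_mulVec, Matrix.vecMulVec_mulVec, EuclideanSpace.inner_eq_star_dotProduct]
  simp [dotProduct_comm]
  exact Or.inl (by ring)

/-- A position of contact points that forces the unit ball to be extremal. -/
structure IsContactSystem {k : ℕ} (g : Rd d → ℝ) (s : ℝ) (u : Fin k → Rd d) (ξ : Fin k → ℝ)
    (c : Fin k → ℝ) : Prop where
  norm_sq : ∀ i, ‖u i‖ ^ 2 + ξ i ^ 2 = 1
  mem_frontier : ∀ i, pt (u i) (ξ i) ∈ frontier (graphBody g)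
  pos : ∀ i, 0 < c i
  sum_tensor : ∑ i, c i • Matrix.vecMulVec (u i).ofLp (u i).ofLp = 1
  sum_sq : ∑ i, c i * ξ i ^ 2 = s
  sum_smul : ∑ i, c i • u i = 0

lemma IsJohnDecomposition.isContactSystem {k : ℕ} {g : Rd d → ℝ} {s : ℝ}
    {u : Fin k → RdOne d} {c : Fin k → ℝ}
    (h : IsJohnDecomposition (graphBody g) (oplus 1 s) u c) :
    IsContactSystem g s (fun i => proj (u i)) (fun i => last (u i)) c where
  norm_sq i := by
    have := (h.1 i).1
    rwa [← pt_proj_last (u i), pt_mem_frontier_unitBall] at this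
  mem_frontier i := by rw [pt_proj_last]; exact (h.1 i).2
  pos := h.2.1
  sum_tensor := by
    have := congrArg Matrix.toBlocks₁₁ h.2.2.1
    rw [oplus, Matrix.toBlocks_fromBlocks₁₁] at this
    rw [← this]
    ext i j
    simp [Matrix.toBlocks₁₁, Matrix.sum_apply, Matrix.vecMulVec_apply, proj]
  sum_sq := by
    have := congrFun (congrFun h.2.2.1 (Sum.inr ())) (Sum.inr ())
    simpa [oplus, Matrix.sum_apply, Matrix.vecMulVec_apply, last, sq] using this
  sum_smul := h.2.2.2

lemma IsContactSystem.det_le_one {k : ℕ} {g : Rd d → ℝ} {s : ℝ} {u : Fin k → Rd d}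
    {ξ c : Fin k → ℝ} (h : IsContactSystem g s u ξ c) (hs : 0 < s) (hg : IsLogConcave g)
    (hB : ∀ x, ballHeight x ≤ g x) {P : Matrix (Fin d) (Fin d) ℝ} (hP : P.PosDef) {r : ℝ}
    (hr : 0 < r) {a : Rd d}
    (hE : ∀ v, ‖v‖ ≤ 1 → r * ballHeight v ≤ g (Matrix.toEuclideanLin P v + a)) :
    r ^ s * P.det ≤ 1 ∧ (r ^ s * P.det = 1 → P = 1 ∧ r = 1 ∧ a = 0) := by
  have hdet := hP.det_pos
  have hle : ∀ i ∈ Finset.univ, c i * (ξ i ^ 2 * Real.log r +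
      inner ℝ (u i) (Matrix.toEuclideanLin P (u i)) + inner ℝ (u i) a) ≤ c i * ‖u i‖ ^ 2 :=
    fun i _ => mul_le_mul_of_nonneg_left (log_add_inner_le_of_mem_frontier hg hB (h.norm_sq i)
      (h.mem_frontier i) _ a hr hE) (h.pos i).le
  have hinner : ∑ i, c i * inner ℝ (u i) a = 0 := by
    simp_rw [← real_inner_smul_left]
    rw [← sum_inner, h.sum_smul, inner_zero_left]
  have hleft : ∑ i, c i * (ξ i ^ 2 * Real.log r +
      inner ℝ (u i) (Matrix.toEuclideanLin P (u i)) + inner ℝ (u i) a) =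
      s * Real.log r + P.trace := by
    simp_rw [mul_add, Finset.sum_add_distrib]
    rw [hinner, sum_mul_inner_toEuclideanLin P h.sum_tensor, Matrix.mul_one, add_zero, ← h.sum_sq,
      Finset.sum_mul]
    simp_rw [mul_assoc]
  have hright : ∑ i, c i * ‖u i‖ ^ 2 = d := by
    have := sum_mul_inner_toEuclideanLin 1 h.sum_tensor
    simpa using this
  have hsum := Finset.sum_le_sum hle
  rw [hleft, hright] at hsum
  obtain ⟨hd1, hd2⟩ := log_det_le_trace_sub hP
  rw [Fintype.card_fin] at hd1 hd2
  have hlog : Real.log (r ^ s * P.det) = s * Real.log r + Real.log P.det := by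
    rw [Real.log_mul (Real.rpow_pos_of_pos hr s).ne' hdet.ne', Real.log_rpow hr]
  have hpos : 0 < r ^ s * P.det := mul_pos (Real.rpow_pos_of_pos hr s) hdet
  constructor
  · rw [← Real.log_nonpos_iff hpos.le, hlog]
    linarith
  · intro heq
    rw [heq, Real.log_one] at hlog
    have hP1 : P = 1 := hd2 (by linarith)
    subst hP1
    have hr1 : r = 1 := by
      rw [Matrix.det_one, Real.log_one, add_zero] at hlog
      exact Real.eq_one_of_pos_of_log_eq_zero hr
        ((mul_eq_zero.1 hlog.symm).resolve_left hs.ne')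
    refine ⟨rfl, hr1, ?_⟩
    subst hr1
    -- With `P = 1` and `r = 1` each contact inequality reduces to `⟨u i, a⟩ ≤ 0`. The weighted sum
    -- vanishes, so every term does, and `‖a‖² = ∑ c i ⟨u i, a⟩²` gives `a = 0`.
    have hle0 : ∀ i ∈ Finset.univ, c i * inner ℝ (u i) a ≤ 0 := by
      intro i hi
      have := hle i hi
      have hT : inner ℝ (u i) (Matrix.toEuclideanLin (1 : Matrix (Fin d) (Fin d) ℝ) (u i)) =
          ‖u i‖ ^ 2 := by simp
      rw [hT, Real.log_one, mul_zero, zero_add, mul_add] at this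
      linarith
    have hz : ∀ i, inner ℝ (u i) a = 0 := by
      intro i
      have := (Finset.sum_eq_zero_iff_of_nonpos hle0).1 hinner i (Finset.mem_univ i)
      exact (mul_eq_zero.1 this).resolve_left (h.pos i).ne'
    have hsq := sum_mul_inner_sq h.sum_tensor a
    simp only [hz] at hsq
    simp only [ne_eq, OfNat.ofNat_ne_zero, not_false_eq_true, zero_pow, mul_zero,
      Finset.sum_const_zero, Matrix.one_mulVec] at hsq
    ext i
    exact congrFun (dotProduct_self_eq_zero.1 hsq.symm) i

end Extremal

/-! ### Contact points imply unique maximality -/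

section Sufficiency

variable {d : ℕ}

lemma sLift_eq_graphBody (s : ℝ) (f : Rd d → ℝ) : sLift s f = graphBody fun x => f x ^ (1 / s) :=
  rfl

lemma symmSubgraph_eq_graphBody (f : Rd d → ℝ) : symmSubgraph f = graphBody fun x => f x / 2 :=
  rfl

/-- The section over `P v + a` is a segment with centre `⟨w, v⟩ + t` and half-length `r h(v)`; the
left side is the absolute value of its endpoint farther from `0`. -/
lemma le_of_affineBall_lowerBlock_subset {g : Rd d → ℝ} {P : Matrix (Fin d) (Fin d) ℝ} {w a : Rd d}
    {r t : ℝ} (hr : 0 < r) (h : affineBall (lowerBlock P w r) (pt a t) ⊆ graphBody g) (v : Rd d)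
    (hv : ‖v‖ ≤ 1) :
    r * ballHeight v + |inner ℝ w v + t| ≤ g (Matrix.toEuclideanLin P v + a) := by
  have hsq := ballHeight_sq hv
  have h0 := mul_nonneg hr.le (ballHeight_nonneg v)
  have key : ∀ ξ : ℝ, ξ ^ 2 = ballHeight v ^ 2 →
      |inner ℝ w v + r * ξ + t| ≤ g (Matrix.toEuclideanLin P v + a) := by
    intro ξ hξ
    rw [← pt_mem_graphBody]
    exact h (mem_affineBall_lowerBlock.2 ⟨v, ξ, by rw [hξ, hsq]; linarith, rfl⟩)
  rcases le_total 0 (inner ℝ w v + t) with hs | hs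
  · refine le_trans ?_ (key (ballHeight v) rfl)
    rw [abs_of_nonneg hs]
    refine le_trans ?_ (le_abs_self _)
    linarith
  · refine le_trans ?_ (key (-ballHeight v) (neg_sq _))
    rw [abs_of_nonpos hs]
    refine le_trans ?_ (neg_le_abs _)
    linarith

lemma IsContactSystem.isUniqueMaximizer_sVolume {k : ℕ} {g : Rd d → ℝ} {s : ℝ} {u : Fin k → Rd d}
    {ξ c : Fin k → ℝ} (h : IsContactSystem g s u ξ c) (hs : 0 < s) (hg : IsLogConcave g)
    (hB : ∀ x, ballHeight x ≤ g x) :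
    IsUniqueMaximizer IsDSymmetricEllipsoid (sVolume s) (graphBody g) (unitBall d) := by
  refine ⟨isDSymmetricEllipsoid_unitBall, (unitBall_subset_graphBody_iff hg.1).2 hB, ?_⟩
  rintro _ ⟨⟨_, a⟩, ⟨A, α, hA, hα, rfl⟩, rfl⟩ hsub
  have hE : ∀ v, ‖v‖ ≤ 1 → α * ballHeight v ≤ g (Matrix.toEuclideanLin A v + a) := by
    intro v hv
    simp only [body] at hsub
    rw [oplus_eq_lowerBlock] at hsub
    exact le_trans (le_add_of_nonneg_right (abs_nonneg _))
      (le_of_affineBall_lowerBlock_subset hα hsub v hv)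
  obtain ⟨h1, h2⟩ := h.det_le_one hs hg hB hA hα hE
  rw [sVolume_body hs hA hα, ofReal_mul_le_self_iff (sVolume_unitBall_ne_zero hs)
    (sVolume_unitBall_ne_top hs), ofReal_mul_eq_self_iff (sVolume_unitBall_ne_zero hs)
    (sVolume_unitBall_ne_top hs)]
  refine ⟨h1, fun heq => ?_⟩
  obtain ⟨rfl, rfl, rfl⟩ := h2 heq
  rw [oplus_one_one, body_one_zero]

open scoped MatrixOrder in
lemma exists_posDef_mul_self_eq {n : Type*} [Fintype n] [DecidableEq n] {M : Matrix n n ℝ}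
    (hM : M.PosDef) : ∃ P : Matrix n n ℝ, P.PosDef ∧ P * P = M := by
  have hnn : 0 ≤ M := hM.posSemidef.nonneg
  have hsq : CFC.sqrt M * CFC.sqrt M = M := CFC.sqrt_mul_sqrt_self M hnn
  refine ⟨CFC.sqrt M, ?_, hsq⟩
  rw [(Matrix.nonneg_iff_posSemidef.1 (CFC.sqrt_nonneg M)).posDef_iff_isUnit, Matrix.isUnit_iff_isUnit_det]
  refine (isUnit_iff_ne_zero.2 fun h0 => hM.det_pos.ne' ?_)
  rw [← hsq, Matrix.det_mul, h0, zero_mul]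

/-- A block Cholesky factorization of `A Aᵀ`: `P` is the square root of the upper left block, `w =
P⁻¹ b`, and `r²` is the Schur complement, positive because both determinants are. -/
lemma exists_lowerBlock_affineBall_eq {A : Matrix (Fin d ⊕ Unit) (Fin d ⊕ Unit) ℝ}
    (hA : A.PosDef) : ∃ (P : Matrix (Fin d) (Fin d) ℝ) (w : Rd d) (r : ℝ), P.PosDef ∧ 0 < r ∧
      ∀ a, affineBall (lowerBlock P w r) a = affineBall A a := by
  have hAT : A.IsSymm := by simpa using hA.1
  have hAu : IsUnit A.det := hA.det_pos.ne'.isUnit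
  have hM : (A * Aᵀ).PosDef := by
    have := Matrix.PosDef.mul_conjTranspose_self A (Matrix.vecMul_injective_of_isUnit
      ((Matrix.isUnit_iff_isUnit_det A).2 hAu))
    simpa using this
  generalize hMM : A * Aᵀ = M at hM
  have hMT : M.IsSymm := by simpa using hM.1
  set M₁ := M.toBlocks₁₁ with hM₁
  set b : Matrix (Fin d) Unit ℝ := M.toBlocks₁₂ with hb
  set D := M.toBlocks₂₂ with hD
  have hblocks : M = Matrix.fromBlocks M₁ b bᵀ D := by
    rw [← Matrix.fromBlocks_toBlocks M]
    congr 1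
    ext i j
    exact hMT.apply _ _
  have h1 : M₁.PosDef := by
    have := hM.submatrix (e := Sum.inl) Sum.inl_injective
    exact this
  obtain ⟨P, hP, hPM⟩ := exists_posDef_mul_self_eq h1
  have hPT : P.IsSymm := by simpa using hP.1
  have hPu : IsUnit P.det := hP.det_pos.ne'.isUnit
  have hM1u : IsUnit M₁.det := h1.det_pos.ne'.isUnit
  let _ := Matrix.invertibleOfIsUnitDet M₁ hM1u
  have hschur : 0 < (D - bᵀ * M₁⁻¹ * b) () () := by
    have hdet := hM.det_pos
    rw [hblocks, Matrix.det_fromBlocks₁₁, Matrix.invOf_eq_nonsing_inv] at hdet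
    have := (mul_pos_iff_of_pos_left h1.det_pos).1 hdet
    rwa [Matrix.det_unique] at this
  set r := √((D - bᵀ * M₁⁻¹ * b) () ()) with hr
  have hr2 : r ^ 2 = (D - bᵀ * M₁⁻¹ * b) () () := Real.sq_sqrt hschur.le
  refine ⟨P, WithLp.toLp 2 (fun j => (P⁻¹ * b) j ()), r, hP, Real.sqrt_pos.2 hschur, fun a => ?_⟩
  refine affineBall_eq_of_mul_transpose_eq hAu ?_ a
  have hW : (Matrix.of fun (_ : Unit) j => (WithLp.toLp 2 (fun j => (P⁻¹ * b) j ()) : Rd d) j) =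
      (P⁻¹ * b)ᵀ := by
    ext i j; rfl
  rw [lowerBlock, hW, hMM, hblocks, Matrix.fromBlocks_transpose, Matrix.fromBlocks_multiply]
  have hPinv : (P⁻¹)ᵀ = P⁻¹ := by rw [Matrix.transpose_nonsing_inv, hPT.eq]
  congr 1
  · rw [hPT.eq, hPM]; simp
  · rw [Matrix.transpose_transpose, ← Matrix.mul_assoc, Matrix.mul_nonsing_inv _ hPu]; simp
  · rw [Matrix.transpose_mul, hPinv, hPT.eq, Matrix.mul_assoc, Matrix.nonsing_inv_mul _ hPu]; simp
  · rw [Matrix.transpose_transpose, Matrix.transpose_mul, hPinv]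
    have hinv : P⁻¹ * P⁻¹ = M₁⁻¹ := by rw [← Matrix.mul_inv_rev, hPM]
    rw [Matrix.mul_assoc, ← Matrix.mul_assoc P⁻¹, hinv, ← Matrix.mul_assoc]
    ext ⟨⟩ ⟨⟩
    simp only [Matrix.add_apply, Matrix.diagonal_transpose, Matrix.diagonal_mul_diagonal,
      Matrix.diagonal_apply_eq]
    rw [← sq, hr2, Matrix.sub_apply]
    ring

lemma IsContactSystem.exists_norm_lt_one {k : ℕ} {g : Rd d → ℝ} {s : ℝ} {u : Fin k → Rd d}
    {ξ c : Fin k → ℝ} (h : IsContactSystem g s u ξ c) (hs : 0 < s) : ∃ i, ‖u i‖ < 1 := by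
  by_contra! hcon
  have hz : ∀ i, ξ i ^ 2 = 0 := fun i => by
    nlinarith [h.norm_sq i, hcon i, sq_nonneg (ξ i)]
  have := h.sum_sq
  simp only [hz, mul_zero, Finset.sum_const_zero] at this
  exact hs.ne this

/-- At `u` the ball already touches the graph, so the shift `⟨w, u⟩ + t` is zero. Along `u - τ w`
the shift has size `|τ| ‖w‖²`, but between `h` and its log-tangent majorant there is only a gap with
zero derivative at `τ = 0`. -/
lemma eq_zero_of_ballHeight_add_abs_le {g : Rd d → ℝ} (hg : IsLogConcave g)
    (hB : ∀ x, ballHeight x ≤ g x) {u : Rd d} {ξ : ℝ} (h1 : ‖u‖ ^ 2 + ξ ^ 2 = 1)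
    (h2 : pt u ξ ∈ frontier (graphBody g)) (hu : ‖u‖ < 1) {w : Rd d} {t : ℝ}
    (hE : ∀ v, ‖v‖ ≤ 1 → ballHeight v + |inner ℝ w v + t| ≤ g v) : w = 0 ∧ t = 0 := by
  have hu0 : inner ℝ w u + t = 0 := by
    have := hE u hu.le
    rw [eq_ballHeight_of_mem_frontier hg hB h1 h2 hu] at this
    exact abs_eq_zero.1 (le_antisymm (by linarith) (abs_nonneg _))
  let F : ℝ → ℝ := fun τ => ballHeight u * Real.exp (-inner ℝ u (-(τ • w)) / ballHeight u ^ 2) -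
    ballHeight (u - τ • w)
  have hF0 : F 0 = 0 := by simp [F]
  have hFd : DifferentiableAt ℝ F 0 := by
    refine DifferentiableAt.sub ?_ (hasDerivAt_ballHeight hu w).differentiableAt
    simp only [inner_neg_right, inner_smul_right]
    fun_prop
  have hF : ∀ᶠ τ : ℝ in 𝓝 0, |τ * ‖w‖ ^ 2| ≤ F τ := by
    have hc : Continuous fun τ : ℝ => ‖u - τ • w‖ := by fun_prop
    filter_upwards [hc.continuousAt.eventually_lt_const (show ‖u - (0 : ℝ) • w‖ < 1 by simpa)]
      with τ hτ
    have := (hE _ hτ.le).trans (le_mul_exp_of_mem_frontier hg hB h1 h2 hu _)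
    rw [sub_sub_cancel_left, inner_sub_right, inner_smul_right, real_inner_self_eq_norm_sq,
      show inner ℝ w u - τ * ‖w‖ ^ 2 + t = -(τ * ‖w‖ ^ 2) by linarith, abs_neg] at this
    simp only [F]
    linarith
  -- Subtracting `e τ ‖w‖²` leaves a local minimum at `0`, so `F'(0) = e ‖w‖²` for each such `e`; `e
  -- = 0` and `e = 1` give `w = 0`.
  have hmin : ∀ e : ℝ, |e| ≤ 1 → deriv F 0 - e * ‖w‖ ^ 2 = 0 := by
    intro e he
    have hd : HasDerivAt (fun τ => F τ - τ * (e * ‖w‖ ^ 2)) (deriv F 0 - e * ‖w‖ ^ 2) 0 := by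
      refine (hFd.hasDerivAt.sub ((hasDerivAt_id (0 : ℝ)).mul_const (e * ‖w‖ ^ 2))).congr_deriv ?_
      simp
    refine IsLocalMin.hasDerivAt_eq_zero ?_ hd
    filter_upwards [hF] with τ hτ
    rw [hF0, zero_mul, sub_zero]
    have h3 : τ * (e * ‖w‖ ^ 2) ≤ |τ * ‖w‖ ^ 2| := by
      rw [show τ * (e * ‖w‖ ^ 2) = e * (τ * ‖w‖ ^ 2) by ring]
      refine (le_abs_self _).trans ?_
      rw [abs_mul]
      exact mul_le_of_le_one_left (abs_nonneg _) he
    linarith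
  have hw : ‖w‖ ^ 2 = 0 := by
    have h3 := hmin 0 (by simp)
    have h4 := hmin 1 (by simp)
    linarith
  have hw0 : w = 0 := by simpa using hw
  subst hw0
  exact ⟨rfl, by simpa using hu0⟩

lemma IsContactSystem.isUniqueMaximizer_volume {k : ℕ} {g : Rd d → ℝ} {u : Fin k → Rd d}
    {ξ c : Fin k → ℝ} (h : IsContactSystem g 1 u ξ c) (hg : IsLogConcave g)
    (hB : ∀ x, ballHeight x ≤ g x) :
    IsUniqueMaximizer IsEllipsoid (fun E => volume E) (graphBody g) (unitBall d) := by
  refine ⟨isEllipsoid_unitBall, (unitBall_subset_graphBody_iff hg.1).2 hB, ?_⟩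
  rintro _ ⟨A, a, hA, rfl⟩ hsub
  obtain ⟨P, w, r, hP, hr, hEq⟩ := exists_lowerBlock_affineBall_eq hA
  rw [← hEq] at hsub ⊢
  obtain ⟨x, t, rfl⟩ : ∃ x t, pt x t = a := ⟨_, _, pt_proj_last a⟩
  have hE := le_of_affineBall_lowerBlock_subset hr hsub
  obtain ⟨h1, h2⟩ := h.det_le_one one_pos hg hB hP hr fun v hv =>
    le_trans (le_add_of_nonneg_right (abs_nonneg _)) (hE v hv)
  have hne0 : volume (unitBall d) ≠ 0 :=
    (Metric.measure_closedBall_pos volume (0 : RdOne d) one_pos).ne'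
  have hnet : volume (unitBall d) ≠ ⊤ := measure_closedBall_lt_top.ne
  beta_reduce
  rw [volume_affineBall, det_lowerBlock, abs_of_pos (mul_pos hP.det_pos hr), ← unitBall,
    ofReal_mul_le_self_iff hne0 hnet, ofReal_mul_eq_self_iff hne0 hnet]
  rw [Real.rpow_one, mul_comm] at h1 h2
  refine ⟨h1, fun heq => ?_⟩
  obtain ⟨rfl, rfl, rfl⟩ := h2 heq
  obtain ⟨i, hi⟩ := h.exists_norm_lt_one one_pos
  obtain ⟨rfl, rfl⟩ := eq_zero_of_ballHeight_add_abs_le hg hB (h.norm_sq i) (h.mem_frontier i) hi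
    (w := w) (t := t) (fun v hv => by simpa using hE v hv)
  rw [← oplus_eq_lowerBlock, oplus_one_one, pt_zero_zero, affineBall_one_zero, unitBall]

end Sufficiency

/-! ### Compactness of convex hulls in finite dimension -/

section ConvexHull

/-- By Carathéodory, `finrank + 1` points suffice, so the hull is a continuous image of a simplex
times a power of `S`. Shorter combinations are padded with weight `0` at `z₀`. -/
lemma isCompact_convexHull_of_finiteDimensional {E : Type*} [AddCommGroup E] [Module ℝ E]
    [TopologicalSpace E] [IsTopologicalAddGroup E] [ContinuousSMul ℝ E] [FiniteDimensional ℝ E]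
    {S : Set E} (hS : IsCompact S) : IsCompact (convexHull ℝ S) := by
  rcases S.eq_empty_or_nonempty with rfl | ⟨z₀, hz₀⟩
  · simp
  let N := Module.finrank ℝ E + 1
  have himage : convexHull ℝ S = (fun p : (Fin N → ℝ) × (Fin N → E) => ∑ i, p.1 i • p.2 i) ''
      (stdSimplex ℝ (Fin N) ×ˢ univ.pi fun _ => S) := by
    apply Subset.antisymm
    · intro x hx
      obtain ⟨ι, _, z, w, hzS, hz, hw, hw1, hwx⟩ := eq_pos_convex_span_of_mem_convexHull hx
      have hcard : Fintype.card ι ≤ Fintype.card (Fin N) := by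
        rw [Fintype.card_fin]
        exact hz.card_le_finrank_succ.trans (Nat.succ_le_succ (Submodule.finrank_le _))
      obtain ⟨e⟩ := Function.Embedding.nonempty_of_card_le hcard
      refine ⟨(Function.extend e w 0, Function.extend e z fun _ => z₀), ⟨⟨fun j => ?_, ?_⟩, ?_⟩, ?_⟩
      · by_cases hj : ∃ i, e i = j
        · obtain ⟨i, rfl⟩ := hj
          simp only [e.injective.extend_apply]
          exact (hw i).le
        · simp only [Function.extend_apply' _ _ _ hj, Pi.zero_apply, le_refl]
      · rw [← hw1]
        refine (Fintype.sum_of_injective e e.injective _ _ (fun j hj => ?_) fun i => ?_).symm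
        · simp only [Function.extend_apply' w _ _ hj, Pi.zero_apply]
        · exact (e.injective.extend_apply _ _ _).symm
      · intro j _
        by_cases hj : ∃ i, e i = j
        · obtain ⟨i, rfl⟩ := hj
          simp only [e.injective.extend_apply]
          exact hzS (mem_range_self i)
        · simp only [Function.extend_apply' _ _ _ hj, hz₀]
      · rw [← hwx]
        refine (Fintype.sum_of_injective e e.injective _ _ (fun j hj => ?_) fun i => ?_).symm
        · simp only [Function.extend_apply' w _ _ hj, Pi.zero_apply, zero_smul]
        · simp only [e.injective.extend_apply]
    · rintro _ ⟨⟨w, z⟩, ⟨⟨hw0, hw1⟩, hz⟩, rfl⟩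
      exact (convex_convexHull ℝ S).sum_mem (fun i _ => hw0 i) hw1
        fun i _ => subset_convexHull ℝ S (hz i (mem_univ i))
  rw [himage]
  refine ((isCompact_stdSimplex ℝ (Fin N)).prod (isCompact_univ_pi fun _ => hS)).image ?_
  fun_prop

end ConvexHull

/-! ### Moving the ball inside `K` while increasing its `s`-volume -/

section Perturbation

/-- Near an interior point of `K` small displacements stay in `K`. The other points of the ball are
contact points, and near these `2⟨z, G z⟩ + t‖G z‖² < 0` keeps the displaced point in the ball.
Compactness makes `t` uniform. -/
lemma eventually_add_smul_mem_of_inner_neg {E : Type*} [NormedAddCommGroup E]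
    [InnerProductSpace ℝ E] [ProperSpace E] {K : Set E} (hK : Metric.closedBall 0 1 ⊆ K)
    {G : E → E} (hG : Continuous G)
    (hC : ∀ z ∈ Metric.sphere (0 : E) 1 ∩ frontier K, inner ℝ z (G z) < 0) :
    ∀ᶠ t : ℝ in 𝓝[>] 0, ∀ z ∈ Metric.closedBall (0 : E) 1, z + t • G z ∈ K := by
  have hcont : Continuous fun p : ℝ × E => p.2 + p.1 • G p.2 := by fun_prop
  -- The conditions `0 < t` and `z` in the ball are repeated in the predicate because the local
  -- claims are made on full neighbourhoods of `(0, z)`.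
  have h : ∀ᶠ t : ℝ in 𝓝 0, ∀ z ∈ Metric.closedBall (0 : E) 1,
      0 < t → z ∈ Metric.closedBall (0 : E) 1 → z + t • G z ∈ K := by
    refine (isCompact_closedBall (0 : E) 1).eventually_forall_of_forall_eventually
      (P := fun t z => 0 < t → z ∈ Metric.closedBall (0 : E) 1 → z + t • G z ∈ K) fun z hz => ?_
    by_cases hzK : z ∈ interior K
    · have : ∀ᶠ p : ℝ × E in 𝓝 (0, z), p.2 + p.1 • G p.2 ∈ interior K :=
        hcont.continuousAt.eventually_mem (isOpen_interior.mem_nhds (by simpa using hzK))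
      filter_upwards [this] with p hp _ _
      exact interior_subset hp
    · have hzf : z ∈ frontier K := ⟨subset_closure (hK hz), hzK⟩
      have hzs : z ∈ Metric.sphere (0 : E) 1 := by
        by_contra hne
        refine hzK (interior_mono hK ?_)
        rw [interior_closedBall _ one_ne_zero, Metric.mem_ball]
        exact lt_of_le_of_ne hz hne
      have hq : Continuous fun p : ℝ × E => 2 * inner ℝ p.2 (G p.2) + p.1 * ‖G p.2‖ ^ 2 := by
        fun_prop
      have : ∀ᶠ p : ℝ × E in 𝓝 (0, z), 2 * inner ℝ p.2 (G p.2) + p.1 * ‖G p.2‖ ^ 2 < 0 := by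
        refine hq.continuousAt.eventually_lt_const ?_
        have := hC z ⟨hzs, hzf⟩
        simp only [zero_mul, add_zero]
        linarith
      filter_upwards [this] with p hp hp0 hpb
      refine hK ?_
      rw [mem_closedBall_zero_iff] at hpb ⊢
      rw [← sq_le_one_iff₀ (norm_nonneg _), norm_add_sq_real, inner_smul_right, norm_smul,
        mul_pow, Real.norm_eq_abs, sq_abs]
      have h1 : ‖p.2‖ ^ 2 ≤ 1 := (sq_le_one_iff₀ (norm_nonneg _)).2 hpb
      nlinarith [mul_neg_of_pos_of_neg hp0 hp]
  filter_upwards [nhdsWithin_le_nhds h, self_mem_nhdsWithin] with t ht ht0 z hz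
  exact ht z hz ht0 hz

lemma eventually_posDef_one_add_smul {n : Type*} [Fintype n] [DecidableEq n] {H : Matrix n n ℝ}
    (hH : H.IsSymm) : ∀ᶠ t : ℝ in 𝓝[>] 0, (1 + t • H).PosDef := by
  let T := (Matrix.toEuclideanLin H).toContinuousLinearMap
  have hlim : Filter.Tendsto (fun t : ℝ => t * ‖T‖) (𝓝 0) (𝓝 0) := by
    have : Continuous fun t : ℝ => t * ‖T‖ := by fun_prop
    simpa using this.tendsto 0
  filter_upwards [nhdsWithin_le_nhds (hlim.eventually_lt_const one_pos), self_mem_nhdsWithin]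
    with t ht ht0
  rw [mem_Ioi] at ht0
  refine Matrix.PosDef.of_dotProduct_mulVec_pos ?_ fun x hx => ?_
  · have : (1 + t • H).IsSymm := by
      rw [Matrix.IsSymm, Matrix.transpose_add, Matrix.transpose_smul, hH.eq, Matrix.transpose_one]
    simpa using this
  · set y : EuclideanSpace ℝ n := WithLp.toLp 2 x with hy
    have hy0 : y ≠ 0 := fun h => hx (congrArg WithLp.ofLp h)
    have heq : star x ⬝ᵥ (1 + t • H) *ᵥ x = ‖y‖ ^ 2 + t * inner ℝ y (T y) := by
      rw [← real_inner_self_eq_norm_sq, EuclideanSpace.inner_eq_star_dotProduct,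
        EuclideanSpace.inner_eq_star_dotProduct, Matrix.add_mulVec, dotProduct_add,
        Matrix.one_mulVec, Matrix.smul_mulVec, dotProduct_smul]
      simp [T, hy, Matrix.toLpLin_apply, dotProduct_comm]
    rw [heq]
    have h1 : -(‖y‖ * (‖T‖ * ‖y‖)) ≤ inner ℝ y (T y) :=
      (neg_le_neg (mul_le_mul_of_nonneg_left (T.le_opNorm y) (norm_nonneg y))).trans
        (neg_le_of_abs_le (abs_real_inner_le_norm y (T y)))
    have h2 : 0 < ‖y‖ ^ 2 := by positivity
    nlinarith [mul_le_mul_of_nonneg_left h1 ht0.le]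

/-- The product is `1` at `t = 0`, with derivative `tr H + s β` there. -/
lemma eventually_one_lt_rpow_mul_det {n : Type*} [Fintype n] [DecidableEq n] {H : Matrix n n ℝ}
    {s β : ℝ} (h : 0 < H.trace + s * β) :
    ∀ᶠ t : ℝ in 𝓝[>] 0, 1 < (1 + t * β) ^ s * (1 + t • H).det := by
  have h1 : HasDerivAt (fun t : ℝ => (1 + t * β) ^ s) (s * β) 0 := by
    have := (((hasDerivAt_id (0 : ℝ)).mul_const β).const_add 1).rpow_const (p := s)
      (Or.inl (by simp))
    refine this.congr_deriv ?_
    simp [mul_comm]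
  have h2 : HasDerivAt (fun t : ℝ => (1 + t • H).det) H.trace 0 := by
    rw [show (fun t : ℝ => (1 + t • H).det) = _ from
      funext fun t => Matrix.det_one_add_smul t H]
    set p := (1 + (Polynomial.X : Polynomial ℝ) • H.map Polynomial.C).det.divX.divX
    have := (((hasDerivAt_id (0 : ℝ)).const_mul H.trace).const_add 1).add
      ((p.hasDerivAt 0).mul ((hasDerivAt_id (0 : ℝ)).pow 2))
    refine this.congr_deriv ?_
    simp
  have h3 : HasDerivAt (fun t : ℝ => (1 + t * β) ^ s * (1 + t • H).det) (H.trace + s * β) 0 := by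
    refine (h1.mul h2).congr_deriv ?_
    simp [add_comm]
  have hlim := h3.tendsto_slope_zero_right
  filter_upwards [hlim.eventually_const_lt h, self_mem_nhdsWithin] with t ht ht0
  rw [mem_Ioi] at ht0
  simp only [zero_add, zero_mul, add_zero, Real.one_rpow, zero_smul, Matrix.det_one, mul_one,
    smul_eq_mul] at ht
  have := (mul_pos_iff_of_pos_left (inv_pos.2 ht0)).1 ht
  linarith

variable {d : ℕ}

/-- The ellipsoids with parameters `(I + tH) ⊕ (1 + tβ)` and `t b` tend to the ball. For small `t >
0` the hypothesis on contact points keeps them in `K`, and the one on the trace makes their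
`s`-volume larger. -/
lemma not_unitBallLocallyMaximal {s : ℝ} (hs : 0 < s) {K : Set (RdOne d)} (hK : unitBall d ⊆ K)
    {H : Matrix (Fin d) (Fin d) ℝ} (hH : H.IsSymm) {β : ℝ} {b : Rd d}
    (hC : ∀ (x : Rd d) (ξ : ℝ), pt x ξ ∈ frontier (unitBall d) ∩ frontier K →
      inner ℝ x (Matrix.toEuclideanLin H x) + β * ξ ^ 2 + inner ℝ x b < 0)
    (htr : 0 < H.trace + s * β) : ¬UnitBallLocallyMaximal s K := by
  intro hmax
  let G : RdOne d → RdOne d := fun z => pt (Matrix.toEuclideanLin H (proj z) + b) (β * last z)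
  have hG : Continuous G := by
    refine continuous_pt.comp (Continuous.prodMk ?_ (continuous_const.mul continuous_last))
    exact ((LinearMap.continuous_of_finiteDimensional _).comp continuous_proj).add
      continuous_const
  have hinner : ∀ (x y : Rd d) (ξ η : ℝ), inner ℝ (pt x ξ) (pt y η) = inner ℝ x y + ξ * η := by
    intro x y ξ η
    simp [EuclideanSpace.inner_eq_star_dotProduct, pt, mul_comm]
  have hmem : ∀ᶠ t : ℝ in 𝓝[>] 0, ∀ z ∈ Metric.closedBall (0 : RdOne d) 1, z + t • G z ∈ K := by
    refine eventually_add_smul_mem_of_inner_neg hK hG fun z hz => ?_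
    rw [← frontier_unitBall, ← pt_proj_last z] at hz
    have := hC _ _ hz
    rw [← pt_proj_last z, hinner, proj_pt, last_pt, inner_add_right]
    linarith
  have hpath : Filter.Tendsto (fun t : ℝ => (oplus (1 + t • H) (1 + t * β), t • b)) (𝓝[>] 0)
      (𝓝 ((1, 0) : Matrix (Fin d ⊕ Unit) (Fin d ⊕ Unit) ℝ × Rd d)) := by
    have hc : Continuous fun t : ℝ => (oplus (1 + t • H) (1 + t * β), t • b) := by
      refine Continuous.prodMk ?_ (by fun_prop)
      unfold oplus
      exact Continuous.matrix_fromBlocks (by fun_prop) continuous_const continuous_const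
        (Continuous.matrix_diagonal (by fun_prop))
    have := hc.tendsto 0
    simp only [zero_smul, add_zero, zero_mul, oplus_one_one] at this
    exact this.mono_left nhdsWithin_le_nhds
  have hβ : ∀ᶠ t : ℝ in 𝓝[>] 0, 0 < 1 + t * β := by
    have hc : Continuous fun t : ℝ => 1 + t * β := by fun_prop
    exact nhdsWithin_le_nhds (hc.continuousAt.eventually_const_lt (by simp))
  obtain ⟨t, h1, h2, h3, h4, h5⟩ := (hmem.and ((hpath.eventually hmax).and (hβ.and
    ((eventually_posDef_one_add_smul hH).and (eventually_one_lt_rpow_mul_det htr))))).exists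
  have hle := h2 ⟨_, _, h4, h3, rfl⟩ ?_
  · rw [sVolume_body hs h4 h3, ofReal_mul_le_self_iff (sVolume_unitBall_ne_zero hs)
      (sVolume_unitBall_ne_top hs)] at hle
    exact hle.not_gt h5
  · intro z hz
    obtain ⟨x, ξ, hx, rfl⟩ := mem_body_oplus.1 hz
    have := h1 (pt x ξ) (pt_mem_unitBall.2 hx)
    simp only [G, proj_pt, last_pt, smul_pt, pt_add] at this
    convert this using 2
    · simp only [map_add, map_smul, LinearMap.add_apply, LinearMap.smul_apply, smul_add]
      rw [show Matrix.toEuclideanLin (1 : Matrix (Fin d) (Fin d) ℝ) x = x by simp]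
      abel
    · ring

end Perturbation

/-! ### Local maximality implies a decomposition -/

section Necessity

variable {d : ℕ}

lemma two_smul_pt_proj_sub (z : RdOne d) :
    (2 : ℝ) • pt (proj z) 0 - z = pt (proj z) (-last z) := by
  conv_lhs => rw [← pt_proj_last z]
  rw [proj_pt, smul_pt, pt_sub]
  congr 1
  · rw [two_smul, add_sub_cancel_right]
  · ring

lemma involutive_neg_last : Function.Involutive fun z : RdOne d => pt (proj z) (-last z) := by
  intro z
  simp

lemma IsDSymmetric.pt_neg_mem_frontier {K : Set (RdOne d)} (hK : IsDSymmetric K) {x : Rd d} {ξ : ℝ}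
    (h : pt x ξ ∈ frontier K) : pt x (-ξ) ∈ frontier K := by
  simp_rw [IsDSymmetric, two_smul_pt_proj_sub] at hK
  have hcont : Continuous fun z : RdOne d => pt (proj z) (-last z) :=
    continuous_pt.comp (continuous_proj.prodMk continuous_last.neg)
  let e : RdOne d ≃ₜ RdOne d := ⟨involutive_neg_last.toPerm, hcont, hcont⟩
  have h1 : e '' frontier K = frontier K := by
    rw [e.image_frontier]
    exact congrArg frontier hK
  rw [← h1]
  refine ⟨pt x ξ, h, ?_⟩
  change pt (proj (pt x ξ)) (-last (pt x ξ)) = _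
  rw [proj_pt, last_pt]

lemma isDSymmetric_graphBody (g : Rd d → ℝ) : IsDSymmetric (graphBody g) := by
  simp_rw [IsDSymmetric, two_smul_pt_proj_sub]
  have hsub : ∀ z ∈ graphBody g, pt (proj z) (-last z) ∈ graphBody g := by
    intro z hz
    rwa [pt_mem_graphBody, abs_neg]
  apply Subset.antisymm
  · rintro _ ⟨z, hz, rfl⟩
    exact hsub z hz
  · intro z hz
    exact ⟨_, hsub z hz, involutive_neg_last z⟩

/-- The matrix `z ⊗ z`, as a function of two indices, together with the projection of `z`. -/
def tensorProj (z : RdOne d) : (Fin d ⊕ Unit → Fin d ⊕ Unit → ℝ) × Rd d :=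
  (fun i j => z i * z j, proj z)

lemma continuous_tensorProj : Continuous (tensorProj (d := d)) := by
  unfold tensorProj
  exact Continuous.prodMk (by fun_prop) continuous_proj

lemma linear_functional_eq {ι κ : Type*} [Fintype ι] [DecidableEq ι] [Fintype κ] [DecidableEq κ]
    (φ : (ι → ι → ℝ) × EuclideanSpace ℝ κ →ₗ[ℝ] ℝ) :
    ∃ (N : Matrix ι ι ℝ) (b : EuclideanSpace ℝ κ), ∀ m v,
      φ (m, v) = ∑ i, ∑ j, m i j * N i j + inner ℝ v b := by
  refine ⟨fun i j => φ (Pi.single i (Pi.single j 1), 0),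
    WithLp.toLp 2 fun i => φ (0, EuclideanSpace.single i 1), fun m v => ?_⟩
  let φ₁ := φ ∘ₗ LinearMap.inl ℝ (ι → ι → ℝ) (EuclideanSpace ℝ κ)
  let φ₂ := φ ∘ₗ LinearMap.inr ℝ (ι → ι → ℝ) (EuclideanSpace ℝ κ)
  have h1 : φ (m, v) = φ₁ m + φ₂ v := by simp [φ₁, φ₂, ← map_add]
  have hm : m = ∑ i, ∑ j, m i j • (Pi.single i (Pi.single j 1) : ι → ι → ℝ) := by
    funext k l
    simp [Finset.sum_apply, Pi.single_apply, ite_apply, Finset.sum_ite_eq]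
  have hv : v = ∑ i, v i • EuclideanSpace.single i (1 : ℝ) := by
    ext k
    simp [Finset.sum_apply, Pi.single_apply]
  have h2 : φ₁ m = ∑ i, ∑ j, m i j * φ (Pi.single i (Pi.single j 1), 0) := by
    conv_lhs => rw [hm]
    simp_rw [map_sum, map_smul]
    rfl
  have h3 : φ₂ v = ∑ i, v i * φ (0, EuclideanSpace.single i 1) := by
    conv_lhs => rw [hv]
    simp_rw [map_sum, map_smul]
    rfl
  rw [h1, h2, h3, EuclideanSpace.inner_eq_star_dotProduct]
  simp [dotProduct, mul_comm]

/-- The factor `(d + s)⁻¹` gives the target trace `1`, the trace of `z ⊗ z` for every unit vector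
`z`. -/
lemma mem_convexHull_of_unitBallLocallyMaximal {s : ℝ} (hs : 0 < s) {K : Set (RdOne d)}
    (hK : IsDSymmetric K) (hB : unitBall d ⊆ K) (hmax : UnitBallLocallyMaximal s K) :
    ((d + s)⁻¹ • ((fun i j => oplus 1 s i j, 0) :
      (Fin d ⊕ Unit → Fin d ⊕ Unit → ℝ) × Rd d)) ∈
      convexHull ℝ (tensorProj '' (frontier (unitBall d) ∩ frontier K)) := by
  by_contra hnot
  have hcompact : IsCompact (tensorProj '' (frontier (unitBall d) ∩ frontier K)) := by
    refine IsCompact.image ?_ continuous_tensorProj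
    rw [frontier_unitBall]
    exact (isCompact_sphere _ _).inter_right isClosed_frontier
  obtain ⟨φ, γ, h1, h2⟩ := geometric_hahn_banach_point_closed (convex_convexHull ℝ _)
    (isCompact_convexHull_of_finiteDimensional hcompact).isClosed hnot
  obtain ⟨N, b, hN⟩ := linear_functional_eq φ.toLinearMap
  change ∀ m v, φ (m, v) = _ at hN
  have hds : (0 : ℝ) < d + s := by positivity
  set N₁ := N.toBlocks₁₁ with hN₁
  set ν := N (Sum.inr ()) (Sum.inr ()) with hν
  have htarget : N₁.trace + s * ν < γ * (d + s) := by
    rw [map_smul, hN, smul_eq_mul, inv_mul_lt_iff₀ hds] at h1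
    have hsum : ∑ i, ∑ j, oplus 1 s i j * N i j = N₁.trace + s * ν := by
      simp [Fintype.sum_sum_type, oplus, Matrix.one_apply, Matrix.trace, N₁, ν,
        Matrix.toBlocks₁₁]
    rw [hsum, inner_zero_left, add_zero] at h1
    linarith
  -- The separating functional exceeds `γ` on contact tensors and is below `γ` at the target. Since
  -- `‖x‖² + ξ² = 1` there, `γ` can be absorbed into the quadratic form; negating the functional and
  -- symmetrizing its upper left block gives `H`, `β` and `b`.
  refine not_unitBallLocallyMaximal hs hB (H := γ • 1 - (2⁻¹ : ℝ) • (N₁ + N₁ᵀ)) (β := γ - ν)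
    (b := -b) ?_ (fun x ξ hx => ?_) ?_ hmax
  · rw [Matrix.IsSymm]
    simp [Matrix.transpose_sub, Matrix.transpose_smul, Matrix.transpose_add, add_comm]
  -- The reflected point is also a contact point; adding the two inequalities cancels the terms
  -- mixing `x` and `ξ`, leaving a block diagonal form.
  · have hx' : pt x (-ξ) ∈ frontier (unitBall d) ∩ frontier K :=
      ⟨pt_mem_frontier_unitBall.2 (by rw [neg_sq]; exact pt_mem_frontier_unitBall.1 hx.1),
        hK.pt_neg_mem_frontier hx.2⟩
    have hval : ∀ η : ℝ, φ (tensorProj (pt x η)) =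
        ∑ i, ∑ j, x i * x j * N₁ i j + η * (∑ i, x i * N (Sum.inl i) (Sum.inr ()) +
          ∑ i, x i * N (Sum.inr ()) (Sum.inl i)) + η ^ 2 * ν + inner ℝ x b := by
      intro η
      rw [tensorProj, hN, proj_pt]
      simp only [Fintype.sum_sum_type, pt, Sum.elim_inl, Sum.elim_inr, Finset.univ_unique,
        Finset.sum_singleton, PUnit.default_eq_unit, Finset.sum_add_distrib, N₁, ν,
        Matrix.toBlocks₁₁, Matrix.of_apply, mul_add, Finset.mul_sum]
      rw [show ∑ i, η * (x i * N (Sum.inl i) (Sum.inr ())) =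
        ∑ i, x i * η * N (Sum.inl i) (Sum.inr ()) from
          Finset.sum_congr rfl fun i _ => by ring]
      rw [show ∑ i, η * (x i * N (Sum.inr ()) (Sum.inl i)) =
        ∑ i, η * x i * N (Sum.inr ()) (Sum.inl i) from
          Finset.sum_congr rfl fun i _ => by ring]
      ring
    have hp := h2 _ (subset_convexHull ℝ _ (mem_image_of_mem _ hx))
    have hm := h2 _ (subset_convexHull ℝ _ (mem_image_of_mem _ hx'))
    rw [hval] at hp hm
    have hquad : ∀ M : Matrix (Fin d) (Fin d) ℝ, inner ℝ x (Matrix.toEuclideanLin M x) =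
        ∑ i, ∑ j, x i * x j * M i j := by
      intro M
      rw [EuclideanSpace.inner_eq_star_dotProduct]
      simp only [Matrix.toLpLin_apply, star_trivial, dotProduct, Matrix.mulVec, Finset.sum_mul]
      exact Finset.sum_congr rfl fun i _ => Finset.sum_congr rfl fun j _ => by ring
    have hT : inner ℝ x (Matrix.toEuclideanLin N₁ᵀ x) = inner ℝ x (Matrix.toEuclideanLin N₁ x) := by
      rw [hquad, hquad, Finset.sum_comm]
      exact Finset.sum_congr rfl fun i _ => Finset.sum_congr rfl fun j _ => by
        rw [Matrix.transpose_apply]; ring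
    have hnorm := pt_mem_frontier_unitBall.1 hx.1
    rw [← hquad] at hp hm
    have hHx : inner ℝ x (Matrix.toEuclideanLin (γ • 1 - (2⁻¹ : ℝ) • (N₁ + N₁ᵀ)) x) =
        γ * ‖x‖ ^ 2 - inner ℝ x (Matrix.toEuclideanLin N₁ x) := by
      rw [map_sub, map_smul, map_smul, map_add, LinearMap.sub_apply, LinearMap.smul_apply,
        LinearMap.smul_apply, LinearMap.add_apply, inner_sub_right, inner_smul_right,
        inner_smul_right, inner_add_right, hT,
        show Matrix.toEuclideanLin (1 : Matrix (Fin d) (Fin d) ℝ) x = x by simp,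
        real_inner_self_eq_norm_sq]
      ring
    have hγ : γ * ‖x‖ ^ 2 + γ * ξ ^ 2 = γ := by rw [← mul_add, hnorm, mul_one]
    rw [hHx, inner_neg_right]
    linarith
  · simp [Matrix.trace_sub, Matrix.trace_smul, Matrix.trace_add]
    linarith

/-- Symmetric matrices are functions on unordered pairs of indices, so the points lie in a space of
dimension `(d + 1)(d + 2)/2 + d`; affine independence allows one more point than that. -/
lemma card_le_of_affineIndependent_tensorProj {ι : Type*} [Fintype ι]
    {p : ι → (Fin d ⊕ Unit → Fin d ⊕ Unit → ℝ) × Rd d} (hp : AffineIndependent ℝ p)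
    (h : ∀ i, p i ∈ range (tensorProj (d := d))) :
    Fintype.card ι ≤ (d + 1) * (d + 2) / 2 + d + 1 := by
  let Ψ : (Sym2 (Fin d ⊕ Unit) → ℝ) × Rd d →ₗ[ℝ] (Fin d ⊕ Unit → Fin d ⊕ Unit → ℝ) × Rd d :=
    { toFun := fun q => (fun i j => q.1 s(i, j), q.2)
      map_add' := fun _ _ => rfl
      map_smul' := fun _ _ => rfl }
  have hrange : vectorSpan ℝ (range p) ≤ LinearMap.range Ψ := by
    rw [vectorSpan_def, Submodule.span_le]
    have hmem : ∀ i, p i ∈ LinearMap.range Ψ := by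
      intro i
      obtain ⟨z, hz⟩ := h i
      rw [← hz]
      exact ⟨(fun e => (e.map z).mul, proj z), rfl⟩
    rintro _ ⟨_, ⟨i, rfl⟩, _, ⟨j, rfl⟩, rfl⟩
    exact Submodule.sub_mem _ (hmem i) (hmem j)
  have h1 := hp.card_le_finrank_succ
  have h2 := (Submodule.finrank_mono hrange).trans Ψ.finrank_range_le
  have h3 : Module.finrank ℝ ((Sym2 (Fin d ⊕ Unit) → ℝ) × Rd d) = (d + 1) * (d + 2) / 2 + d := by
    rw [Module.finrank_prod, Module.finrank_fintype_fun_eq_card, Sym2.card, finrank_euclideanSpace,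
      Fintype.card_fin, Fintype.card_sum, Fintype.card_fin, Fintype.card_unit, Nat.choose_two_right]
    simp [mul_comm]
  omega

/-- A vector orthogonal to every `u i` is killed by the invertible matrix `I ⊕ s`, so the `u i` span
`ℝ^(d+1)`. -/
lemma IsJohnDecomposition.succ_le {K : Set (RdOne d)} {s : ℝ} (hs : s ≠ 0) {k : ℕ}
    {u : Fin k → RdOne d} {c : Fin k → ℝ} (h : IsJohnDecomposition K (oplus 1 s) u c) :
    d + 1 ≤ k := by
  let T : RdOne d →ₗ[ℝ] (Fin k → ℝ) := LinearMap.pi fun i => (innerₗ (RdOne d) (u i))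
  have hT : Function.Injective T := by
    rw [injective_iff_map_eq_zero]
    intro z hz
    have hz' : ∀ i, inner ℝ (u i) z = 0 := fun i => congrFun hz i
    have hS : oplus 1 s *ᵥ z.ofLp = 0 := by
      rw [← h.2.2.1, Matrix.sum_mulVec]
      refine Finset.sum_eq_zero fun i _ => ?_
      have : (u i).ofLp ⬝ᵥ z.ofLp = 0 := by
        have := hz' i
        rw [EuclideanSpace.inner_eq_star_dotProduct, dotProduct_comm] at this
        simpa using this
      rw [Matrix.smul_mulVec, Matrix.vecMulVec_mulVec, this]
      simp
    have hdet : (oplus 1 s : Matrix (Fin d ⊕ Unit) (Fin d ⊕ Unit) ℝ).det ≠ 0 := by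
      rw [oplus_eq_lowerBlock, det_lowerBlock, Matrix.det_one, one_mul]
      exact hs
    have := Matrix.eq_zero_of_mulVec_eq_zero hdet hS
    ext i
    exact congrFun this i
  have := LinearMap.finrank_le_finrank_of_injective hT
  simpa using this

theorem exists_johnDecomposition {s : ℝ} (hs : 0 < s) {K : Set (RdOne d)}
    (hK : IsDSymmetric K) (hB : unitBall d ⊆ K) (hmax : UnitBallLocallyMaximal s K) :
    ∃ k : ℕ, d + 1 ≤ k ∧ k ≤ (d + 1) * (d + 2) / 2 + d + 1 ∧
      ∃ (u : Fin k → RdOne d) (c : Fin k → ℝ), IsJohnDecomposition K (oplus 1 s) u c := by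
  have hds : (0 : ℝ) < d + s := by positivity
  obtain ⟨ι, _, z, w, hzS, hz, hw, hw1, hwx⟩ := eq_pos_convex_span_of_mem_convexHull
    (mem_convexHull_of_unitBallLocallyMaximal hs hK hB hmax)
  choose v hv hvz using fun i => hzS (mem_range_self i)
  let e := (Fintype.equivFin ι).symm
  have hdec : IsJohnDecomposition K (oplus 1 s) (fun i => v (e i)) (fun i => (d + s) * w (e i)) := by
    have hsum : ∑ i, ((d + s) * w (e i)) • tensorProj (v (e i)) =
        ((fun i j => oplus 1 s i j, 0) : (Fin d ⊕ Unit → Fin d ⊕ Unit → ℝ) × Rd d) := by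
      rw [e.sum_comp fun i => ((d + s) * w i) • tensorProj (v i)]
      simp_rw [mul_smul, ← Finset.smul_sum, hvz, hwx]
      rw [smul_smul, mul_inv_cancel₀ hds.ne', one_smul]
    refine ⟨fun i => hv (e i), fun i => mul_pos hds (hw _), ?_, ?_⟩
    · have := congrArg Prod.fst hsum
      rw [Prod.fst_sum] at this
      exact this
    · have := congrArg Prod.snd hsum
      rw [Prod.snd_sum] at this
      exact this
  refine ⟨Fintype.card ι, hdec.succ_le hs.ne', ?_, _, _, hdec⟩
  exact card_le_of_affineIndependent_tensorProj hz fun i => ⟨v i, hvz i⟩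

end Necessity

/-! ### Equivalences for volume and for John functions -/

section Characterizations

variable {d : ℕ}

lemma IsUniqueMaximizer.unitBallLocallyMaximal_sVolume {s : ℝ} {K : Set (RdOne d)}
    (h : IsUniqueMaximizer IsDSymmetricEllipsoid (sVolume s) K (unitBall d)) :
    UnitBallLocallyMaximal s K :=
  Filter.Eventually.of_forall fun p hp hsub => (h.2.2 _ ⟨p, hp, rfl⟩ hsub).1

/-- On `d`-symmetric ellipsoids, volume and `1`-volume are the same factor `α det A` times their
values at the ball. -/
lemma IsUniqueMaximizer.unitBallLocallyMaximal_volume {K : Set (RdOne d)}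
    (h : IsUniqueMaximizer IsEllipsoid (fun E => volume E) K (unitBall d)) :
    UnitBallLocallyMaximal 1 K := by
  refine Filter.Eventually.of_forall ?_
  rintro ⟨_, a⟩ ⟨A, α, hA, hα, rfl⟩ hsub
  have hle := (h.2.2 _ (IsDSymmetricEllipsoid.isEllipsoid ⟨_, ⟨A, α, hA, hα, rfl⟩, rfl⟩) hsub).1
  have hne0 : volume (unitBall d) ≠ 0 :=
    (Metric.measure_closedBall_pos volume (0 : RdOne d) one_pos).ne'
  have hnet : volume (unitBall d) ≠ ⊤ := measure_closedBall_lt_top.ne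
  beta_reduce at hle
  rw [body, volume_affineBall, oplus_eq_lowerBlock, det_lowerBlock,
    abs_of_pos (mul_pos hA.det_pos hα), ← unitBall, ofReal_mul_le_self_iff hne0 hnet] at hle
  rw [sVolume_body one_pos hA hα, ofReal_mul_le_self_iff (sVolume_unitBall_ne_zero one_pos)
    (sVolume_unitBall_ne_top one_pos), Real.rpow_one, mul_comm]
  exact hle

/-- The `s`-volume is the total mass of the `s`-marginal, so an optimal ellipsoid with the marginal
of the ball ties with the ball, and uniqueness identifies them. -/
lemma isJohnFunction_ballHeight_iff {s : ℝ} (hs : 0 < s) {f : Rd d → ℝ}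
    (hB : unitBall d ⊆ sLift s f) :
    IsJohnFunction s f (fun x => ballHeight x ^ s) ↔ IsJohnEllipsoid s f (unitBall d) := by
  constructor
  · rintro ⟨E, hE, hmarg⟩
    have hvol : sVolume s (unitBall d) = sVolume s E := by
      rw [sVolume_eq_sMarginal_univ, sVolume_eq_sMarginal_univ, hmarg, sMarginal_unitBall hs]
    rwa [(hE.2.2 _ isDSymmetricEllipsoid_unitBall hB).2 hvol]
  · intro h
    exact ⟨_, h, sMarginal_unitBall hs⟩

/-- Each point `(u, η)` with `η > h(u)` is outside the body or, if zeros of `g` accumulate at `u`, a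
limit of points outside; then let `η` decrease to `h(u)`. -/
lemma pt_ballHeight_mem_frontier {g : Rd d → ℝ} (hB : ∀ x, ballHeight x ≤ g x) {u : Rd d}
    (h : g u = ballHeight u ∨ u ∈ closure {x | g x = 0}) :
    pt u (ballHeight u) ∈ frontier (graphBody g) := by
  rw [frontier_eq_closure_inter_closure]
  refine ⟨subset_closure ?_, ?_⟩
  · rw [pt_mem_graphBody, abs_of_nonneg (ballHeight_nonneg u)]
    exact hB u
  · have hpos : ∀ η > ballHeight u, pt u η ∈ closure (graphBody g)ᶜ := by
      intro η hη
      have hη0 : 0 < η := (ballHeight_nonneg u).trans_lt hη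
      rcases h with h | h
      · refine subset_closure ?_
        rwa [mem_compl_iff, pt_mem_graphBody, h, abs_of_pos hη0, not_le]
      · have hc : Continuous fun x : Rd d => pt x η :=
          continuous_pt.comp (Continuous.prodMk_left η)
        refine map_mem_closure (f := fun x => pt x η) hc h fun x hx => ?_
        have hx : g x = 0 := hx
        rwa [mem_compl_iff, pt_mem_graphBody, hx, abs_of_pos hη0, not_le]
    have hlim : Filter.Tendsto (fun η => pt u η) (𝓝[>] ballHeight u)
        (𝓝 (pt u (ballHeight u))) :=
      ((continuous_pt.comp (Continuous.prodMk_right u)).tendsto _).mono_left nhdsWithin_le_nhds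
    exact isClosed_closure.mem_of_tendsto hlim
      (Filter.eventually_of_mem self_mem_nhdsWithin hpos)

/-- The points `ρ u` with `ρ > 1` violate `⟨u, x⟩ ≤ 1`, so `g` vanishes there. -/
lemma mem_closure_of_mem_frontier_of_norm_eq_one {g : Rd d → ℝ} (hg : IsLogConcave g)
    (hB : ∀ x, ballHeight x ≤ g x) {u : Rd d} {ξ : ℝ} (h1 : ‖u‖ ^ 2 + ξ ^ 2 = 1)
    (h2 : pt u ξ ∈ frontier (graphBody g)) (hu : ‖u‖ = 1) : u ∈ closure {x | g x = 0} := by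
  have hlim : Filter.Tendsto (fun ρ : ℝ => ρ • u) (𝓝[>] 1) (𝓝 u) := by
    have hc : Continuous fun ρ : ℝ => ρ • u := by fun_prop
    have := hc.tendsto 1
    rw [one_smul] at this
    exact this.mono_left nhdsWithin_le_nhds
  refine mem_closure_of_tendsto hlim ?_
  filter_upwards [self_mem_nhdsWithin] with ρ hρ
  rw [mem_Ioi] at hρ
  by_contra hne
  have := inner_le_one_of_mem_frontier hg hB h1 h2 hu ((hg.1 _).lt_of_ne' hne)
  rw [inner_smul_right, real_inner_self_eq_norm_sq, hu] at this
  linarith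

lemma rpow_one_div_eq_iff {s a b : ℝ} (hs : 0 < s) (ha : 0 ≤ a) (hb : 0 ≤ b) :
    a ^ (1 / s) = b ↔ a = b ^ s := by
  rw [one_div]
  exact Real.rpow_inv_eq ha hb hs.ne'

lemma le_rpow_one_div_iff {s a b : ℝ} (hs : 0 < s) (ha : 0 ≤ a) (hb : 0 ≤ b) :
    b ≤ a ^ (1 / s) ↔ b ^ s ≤ a := by
  rw [one_div]
  exact Real.le_rpow_inv_iff_of_pos hb ha hs

theorem isJohnEllipsoid_unitBall_iff {s : ℝ} (hs : 0 < s) {f : Rd d → ℝ} (hf : IsLogConcave f)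
    (hB : ∀ x, ballHeight x ^ s ≤ f x) :
    IsJohnEllipsoid s f (unitBall d) ↔ ∃ (k : ℕ) (u : Fin k → Rd d) (c : Fin k → ℝ),
      (∀ i, u i ∈ Metric.closedBall (0 : Rd d) 1) ∧ (∀ i, 0 < c i) ∧
      (∀ i, f (u i) = ballHeight (u i) ^ s ∨ u i ∈ frontier {x | 0 < f x}) ∧
      ∑ i, c i • Matrix.vecMulVec (u i).ofLp (u i).ofLp = 1 ∧
      ∑ i, c i * (ballHeight (u i) * ballHeight (u i)) = s ∧
      ∑ i, c i • u i = 0 := by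
  have hs' : 1 / s ≠ 0 := by positivity
  have hg : IsLogConcave fun x => f x ^ (1 / s) := hf.rpow (by positivity)
  have hBg : ∀ x, ballHeight x ≤ f x ^ (1 / s) := fun x =>
    (le_rpow_one_div_iff hs (hf.1 x) (ballHeight_nonneg x)).2 (hB x)
  have hsub : unitBall d ⊆ sLift s f := (unitBall_subset_graphBody_iff hg.1).2 hBg
  have hzero : {x | f x ^ (1 / s) = 0} = {x | 0 < f x}ᶜ := by
    ext x
    rw [mem_compl_iff, mem_ofPred_eq, mem_ofPred_eq, not_lt, Real.rpow_eq_zero (hf.1 x) hs']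
    exact ⟨le_of_eq, fun h => le_antisymm h (hf.1 x)⟩
  constructor
  · intro h
    obtain ⟨k, -, -, u, c, hdec⟩ := exists_johnDecomposition hs (isDSymmetric_graphBody fun x => f x ^ (1 / s)) hsub
      (IsUniqueMaximizer.unitBallLocallyMaximal_sVolume h)
    have hc := hdec.isContactSystem
    have hle : ∀ i, ‖proj (u i)‖ ≤ 1 := fun i => norm_le_one_of_sq_add_sq_le (hc.norm_sq i).le
    refine ⟨k, fun i => proj (u i), c, fun i => by simpa using hle i, hc.pos, fun i => ?_,
      hc.sum_tensor, ?_, hc.sum_smul⟩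
    · rcases (hle i).lt_or_eq with hu | hu
      · left
        rw [← rpow_one_div_eq_iff hs (hf.1 _) (ballHeight_nonneg _)]
        exact eq_ballHeight_of_mem_frontier hg hBg (hc.norm_sq i) (hc.mem_frontier i) hu
      -- On the unit sphere `h = 0`: if `f` vanishes at the point it agrees with `h^s`; otherwise
      -- the point is in `{f > 0}` and a limit of zeros of `f`, hence on the boundary.
      · rcases (hf.1 (proj (u i))).eq_or_lt with h0 | h0
        · left
          rw [← h0, ballHeight_eq_zero hu.ge, Real.zero_rpow hs.ne']
        · right
          rw [frontier_eq_closure_inter_closure, ← hzero]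
          exact ⟨subset_closure h0, mem_closure_of_mem_frontier_of_norm_eq_one hg hBg
            (hc.norm_sq i) (hc.mem_frontier i) hu⟩
    · rw [← hc.sum_sq]
      refine Finset.sum_congr rfl fun i _ => ?_
      rw [← sq, ballHeight_eq_abs (hc.norm_sq i), sq_abs]
  · rintro ⟨k, u, c, hu, hpos, hcontact, htensor, hsq, hsum⟩
    have hc : IsContactSystem (fun x => f x ^ (1 / s)) s u (fun i => ballHeight (u i)) c :=
      { norm_sq := fun i => by
          rw [ballHeight_sq (by simpa using hu i)]; ring
        mem_frontier := fun i => by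
          refine pt_ballHeight_mem_frontier hBg ((hcontact i).imp (fun h => ?_) fun h => ?_)
          · rwa [rpow_one_div_eq_iff hs (hf.1 _) (ballHeight_nonneg _)]
          · rw [frontier_eq_closure_inter_closure, ← hzero] at h
            exact h.2
        pos := hpos
        sum_tensor := htensor
        sum_sq := by simpa only [sq] using hsq
        sum_smul := hsum }
    exact hc.isUniqueMaximizer_sVolume hs hg hBg

end Characterizations

end FunctionalJohn

theorem theorem5p1 (d : ℕ) :
    -- a locally maximal unit ball has a decomposition of the identity
    (∀ (s : ℝ) (K : Set (RdOne d)), 0 < s → IsClosed K → IsDSymmetric K → unitBall d ⊆ K →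
      UnitBallLocallyMaximal s K →
      ∃ k : ℕ, d + 1 ≤ k ∧ k ≤ (d + 1) * (d + 2) / 2 + d + 1 ∧
        ∃ (u : Fin k → RdOne d) (c : Fin k → ℝ), IsJohnDecomposition K (oplus 1 s) u c) ∧
    -- a decomposition makes the unit ball the unique global maximizer
    (∀ (s : ℝ) (f : Rd d → ℝ), 0 < s → IsProperLogConcave f → unitBall d ⊆ sLift s f →
      (∃ (k : ℕ) (u : Fin k → RdOne d) (c : Fin k → ℝ),
        IsJohnDecomposition (sLift s f) (oplus 1 s) u c) →
      IsUniqueMaximizer IsDSymmetricEllipsoid (sVolume s) (sLift s f) (unitBall d)) ∧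
    -- the case of the symmetrized subgraph and of all ellipsoids
    (∀ f : Rd d → ℝ, IsLogConcave f → UpperSemicontinuous f →
      0 < ∫⁻ x, ENNReal.ofReal (f x) → unitBall d ⊆ symmSubgraph f →
      (IsUniqueMaximizer IsEllipsoid (fun E => volume E) (symmSubgraph f) (unitBall d) ↔
        ∃ (k : ℕ) (u : Fin k → RdOne d) (c : Fin k → ℝ),
          IsJohnDecomposition (symmSubgraph f) 1 u c)) ∧
    -- the functional form
    (∀ (s : ℝ) (f : Rd d → ℝ), 0 < s → IsProperLogConcave f →
      (∀ x, ballHeight x ^ s ≤ f x) →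
      (IsJohnFunction s f (fun x => ballHeight x ^ s) ↔
        ∃ (k : ℕ) (u : Fin k → Rd d) (c : Fin k → ℝ),
          (∀ i, u i ∈ Metric.closedBall (0 : Rd d) 1) ∧ (∀ i, 0 < c i) ∧
          (∀ i, f (u i) = ballHeight (u i) ^ s ∨ u i ∈ frontier {x | 0 < f x}) ∧
          ∑ i, c i • Matrix.vecMulVec (u i).ofLp (u i).ofLp = 1 ∧
          ∑ i, c i * (ballHeight (u i) * ballHeight (u i)) = s ∧
          ∑ i, c i • u i = 0)) := by
  refine ⟨?_, ?_, ?_, ?_⟩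
  · intro s K hs _ hK hB hmax
    exact exists_johnDecomposition hs hK hB hmax
  · rintro s f hs hf hB ⟨k, u, c, h⟩
    have hg : IsLogConcave fun x => f x ^ (1 / s) := hf.1.rpow (by positivity)
    rw [sLift_eq_graphBody] at h hB ⊢
    exact h.isContactSystem.isUniqueMaximizer_sVolume hs hg
      ((unitBall_subset_graphBody_iff hg.1).1 hB)
  · intro f hf _ _ hB
    have hg : IsLogConcave fun x => f x / 2 := hf.div_const two_pos
    -- The identity of `ℝ^(d+1)` is `I ⊕ 1`, so this is the case `s = 1` of the decomposition.
    rw [symmSubgraph_eq_graphBody, ← oplus_one_one] at *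
    constructor
    · intro h
      obtain ⟨k, -, -, u, c, hdec⟩ := exists_johnDecomposition one_pos (isDSymmetric_graphBody _)
        hB h.unitBallLocallyMaximal_volume
      exact ⟨k, u, c, hdec⟩
    · rintro ⟨k, u, c, h⟩
      exact h.isContactSystem.isUniqueMaximizer_volume hg
        ((unitBall_subset_graphBody_iff hg.1).1 hB)
  · intro s f hs hf hB
    have hg : IsLogConcave fun x => f x ^ (1 / s) := hf.1.rpow (by positivity)
    rw [isJohnFunction_ballHeight_iff hs, isJohnEllipsoid_unitBall_iff hs hf.1 hB]
    rw [sLift_eq_graphBody, unitBall_subset_graphBody_iff hg.1]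
    exact fun x => (le_rpow_one_div_iff hs (hf.1.1 x) (ballHeight_nonneg x)).2 (hB x)
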